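/- Let $n\ge 1$ and let $(M,g)$ be a connected $(n+1)$-dimensional smooth Lorentzian manifold (Hausdorff, second countable, without boundary) of signature $(-,+,\dots,+)$. Let $\mathcal A_M$ denote the real Lie algebra of Killing vectors of $(M,g)$, that is, of the smooth vector fields $\xi$ with $\mathcal L_\xi g=0$, with the Lie bracket of vector fields. A smooth embedded hypersurface (without boundary) of $M$ is null if the metric induced on each of its tangent spaces is degenerate. A Killing horizon of $\xi\in\mathcal A_M$ is a non-empty smooth embedded null hypersurface $\mathcal H_\xi\subset M$ on which $\xi$ is null, nowhere zero and tangent to $\mathcal H_\xi$, and which is either connected or such that the interior of its closure is a smooth connected hypersurface; here the interior of $\overline{\mathcal H_\xi}$ is the set of points of $\overline{\mathcal H_\xi}$ near which $\overline{\mathcal H_\xi}$ is a smooth embedded hypersurface without boundary. A smooth embedded null hypersurface $\mathcal H\subset M$ is a multiple Killing horizon if there are $m\ge 2$ linearly independent Killing vectors $\xi_1,\dots,\xi_m$ with Killing horizons $\mathcal H_{\xi_1},\dots,\mathcal H_{\xi_m}$ such that $\overline{\mathcal H}=\overline{\mathcal H_{\xi_1}}=\dots=\overline{\mathcal H_{\xi_m}}$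 (closures in $M$). Theorem. Let $\mathcal H$ be a multiple Killing horizon in $(M,g)$, and let $\mathcal A_{\mathcal H}\subset\mathcal A_M$ be the set consisting of the zero vector and of all Killing vectors $\xi$ which admit a Killing horizon $\mathcal H_\xi$ with $\overline{\mathcal H_\xi}=\overline{\mathcal H}$. Then $\mathcal A_{\mathcal H}$ is a Lie subalgebra of $\mathcal A_M$. -/

import Mathlib

open Set Filter Topology Bundle VectorField
open scoped Manifold ContDiff

noncomputable section

/-- Smooth vector fields on a manifold `M` of dimension `n + 1`. -/
abbrev SmoothVectorField (n : ℕ) (M : Type*) [TopologicalSpace M]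
    [ChartedSpace (EuclideanSpace ℝ (Fin (n + 1))) M] [IsManifold (𝓡 (n + 1)) ∞ M] :=
  ContMDiffSection (𝓡 (n + 1)) (EuclideanSpace ℝ (Fin (n + 1))) ∞
    (TangentSpace (𝓡 (n + 1)) : M → Type _)

section VectorFields

variable {n : ℕ} {M : Type*} [TopologicalSpace M]
  [ChartedSpace (EuclideanSpace ℝ (Fin (n + 1))) M] [IsManifold (𝓡 (n + 1)) ∞ M]

theorem contMDiffAt_lieBracket_aux
    {X Y : (x : M) → TangentSpace (𝓡 (n + 1)) x} {p : M}
    (hX : ContMDiffAt (𝓡 (n + 1)) (𝓡 (n + 1)).tangent ∞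
      (fun x ↦ (X x : TangentBundle (𝓡 (n + 1)) M)) p)
    (hY : ContMDiffAt (𝓡 (n + 1)) (𝓡 (n + 1)).tangent ∞
      (fun x ↦ (Y x : TangentBundle (𝓡 (n + 1)) M)) p) :
    ContMDiffAt (𝓡 (n + 1)) (𝓡 (n + 1)).tangent ∞
      (fun x ↦ (mlieBracket (𝓡 (n + 1)) X Y x : TangentBundle (𝓡 (n + 1)) M)) p := by
  have : IsManifold (𝓡 (n + 1)) (((⊤ : ℕ∞) : WithTop ℕ∞) + 1) M := by
    have h : (((⊤ : ℕ∞) : WithTop ℕ∞) + 1) = ∞ := rfl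
    rw [h]; infer_instance
  have : IsManifold (𝓡 (n + 1)) (minSmoothness ℝ 2) M :=
    IsManifold.of_le (n := ∞) (by simpa using WithTop.coe_le_coe.2 (le_top : (2 : ℕ∞) ≤ ⊤))
  exact ContMDiffAt.mlieBracket_vectorField (n := ⊤) (m := ⊤) hX hY (by simp)

theorem SmoothVectorField.mdiffAt (X : SmoothVectorField n M) (p : M) :
    MDifferentiableAt (𝓡 (n + 1)) (𝓡 (n + 1)).tangent
      (fun x ↦ (X x : TangentBundle (𝓡 (n + 1)) M)) p :=
  (X.contMDiff p).mdifferentiableAt (by simp)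

/-- The Lie bracket of smooth vector fields. -/
instance : Bracket (SmoothVectorField n M) (SmoothVectorField n M) where
  bracket X Y := ⟨mlieBracket (𝓡 (n + 1)) X Y,
    fun p ↦ contMDiffAt_lieBracket_aux (X.contMDiff p) (Y.contMDiff p)⟩

theorem SmoothVectorField.bracket_apply (X Y : SmoothVectorField n M) (p : M) :
    ⁅X, Y⁆ p = mlieBracket (𝓡 (n + 1)) X Y p := rfl

theorem leibniz_aux {X Y Z : (x : M) → TangentSpace (𝓡 (n + 1)) x} {p : M}
    (hX : ContMDiffAt (𝓡 (n + 1)) (𝓡 (n + 1)).tangent ∞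
      (fun x ↦ (X x : TangentBundle (𝓡 (n + 1)) M)) p)
    (hY : ContMDiffAt (𝓡 (n + 1)) (𝓡 (n + 1)).tangent ∞
      (fun x ↦ (Y x : TangentBundle (𝓡 (n + 1)) M)) p)
    (hZ : ContMDiffAt (𝓡 (n + 1)) (𝓡 (n + 1)).tangent ∞
      (fun x ↦ (Z x : TangentBundle (𝓡 (n + 1)) M)) p) :
    mlieBracket (𝓡 (n + 1)) X (mlieBracket (𝓡 (n + 1)) Y Z) p =
      mlieBracket (𝓡 (n + 1)) (mlieBracket (𝓡 (n + 1)) X Y) Z p +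
        mlieBracket (𝓡 (n + 1)) Y (mlieBracket (𝓡 (n + 1)) X Z) p := by
  have h2 : minSmoothness ℝ 2 ≤ (∞ : WithTop ℕ∞) := by
    simpa using WithTop.coe_le_coe.2 (le_top : (2 : ℕ∞) ≤ ⊤)
  have h3 : minSmoothness ℝ 3 ≤ (∞ : WithTop ℕ∞) := by
    simpa using WithTop.coe_le_coe.2 (le_top : (3 : ℕ∞) ≤ ⊤)
  have : IsManifold (𝓡 (n + 1)) (minSmoothness ℝ 3) M := IsManifold.of_le h3
  exact leibniz_identity_mlieBracket_apply (hX.of_le h2) (hY.of_le h2) (hZ.of_le h2)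

/-- The Lie ring of smooth vector fields. -/
instance : LieRing (SmoothVectorField n M) where
  add_lie X Y Z := by
    ext1 p
    exact mlieBracket_add_left (X.mdiffAt p) (Y.mdiffAt p)
  lie_add X Y Z := by
    ext1 p
    exact mlieBracket_add_right (Y.mdiffAt p) (Z.mdiffAt p)
  lie_self X := by
    ext1 p
    exact congrFun mlieBracket_self p
  leibniz_lie X Y Z := by
    ext1 p
    exact leibniz_aux (X.contMDiff p) (Y.contMDiff p) (Z.contMDiff p)

/-- The real Lie algebra of smooth vector fields. -/
instance : LieAlgebra ℝ (SmoothVectorField n M) where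
  lie_smul c X Y := by
    ext1 p
    exact mlieBracket_const_smul_right (Y.mdiffAt p)

end VectorFields

/-- A smooth Lorentzian metric of signature `(-, +, …, +)` on a manifold of dimension `n + 1`:
at every point there is a timelike vector on whose orthogonal complement the metric is positive
definite. -/
structure LorentzianMetric (n : ℕ) (M : Type*) [TopologicalSpace M]
    [ChartedSpace (EuclideanSpace ℝ (Fin (n + 1))) M] [IsManifold (𝓡 (n + 1)) ∞ M] where
  /-- The bilinear form on each tangent space. -/
  val (p : M) : TangentSpace (𝓡 (n + 1)) p →L[ℝ] TangentSpace (𝓡 (n + 1)) p →L[ℝ] ℝ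
  symm (p : M) (v w : TangentSpace (𝓡 (n + 1)) p) : val p v w = val p w v
  signature (p : M) : ∃ t : TangentSpace (𝓡 (n + 1)) p, val p t t < 0 ∧
    ∀ v : TangentSpace (𝓡 (n + 1)) p, val p t v = 0 → v ≠ 0 → 0 < val p v v
  contMDiff : ContMDiff (𝓡 (n + 1))
    ((𝓡 (n + 1)).prod 𝓘(ℝ, EuclideanSpace ℝ (Fin (n + 1)) →L[ℝ]
      EuclideanSpace ℝ (Fin (n + 1)) →L[ℝ] ℝ)) ∞
    (fun p ↦ TotalSpace.mk' (EuclideanSpace ℝ (Fin (n + 1)) →L[ℝ]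
      EuclideanSpace ℝ (Fin (n + 1)) →L[ℝ] ℝ) p (val p))

section Defs

variable {n : ℕ} {M : Type*} [TopologicalSpace M]
  [ChartedSpace (EuclideanSpace ℝ (Fin (n + 1))) M] [IsManifold (𝓡 (n + 1)) ∞ M]

/-- `ξ` is a Killing vector of `g`: the Lie derivative of `g` along `ξ` vanishes, that is,
`ξ (g (X, Y)) = g ([ξ, X], Y) + g (X, [ξ, Y])` for all (locally defined) smooth vector fields. -/
def IsKilling (g : LorentzianMetric n M) (ξ : SmoothVectorField n M) : Prop :=
  ∀ (U : Set M), IsOpen U → ∀ X Y : (x : M) → TangentSpace (𝓡 (n + 1)) x,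
    ContMDiffOn (𝓡 (n + 1)) (𝓡 (n + 1)).tangent ∞
      (fun x ↦ (X x : TangentBundle (𝓡 (n + 1)) M)) U →
    ContMDiffOn (𝓡 (n + 1)) (𝓡 (n + 1)).tangent ∞
      (fun x ↦ (Y x : TangentBundle (𝓡 (n + 1)) M)) U →
    ∀ p ∈ U, mvfderiv (𝓡 (n + 1)) (fun x ↦ g.val x (X x) (Y x)) p (ξ p) =
      g.val p (mlieBracket (𝓡 (n + 1)) ξ X p) (Y p) +
        g.val p (X p) (mlieBracket (𝓡 (n + 1)) ξ Y p)

theorem LorentzianMetric.contMDiffAt_apply (g : LorentzianMetric n M)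
    {X Y : (x : M) → TangentSpace (𝓡 (n + 1)) x} {p : M}
    (hX : ContMDiffAt (𝓡 (n + 1)) (𝓡 (n + 1)).tangent ∞
      (fun x ↦ (X x : TangentBundle (𝓡 (n + 1)) M)) p)
    (hY : ContMDiffAt (𝓡 (n + 1)) (𝓡 (n + 1)).tangent ∞
      (fun x ↦ (Y x : TangentBundle (𝓡 (n + 1)) M)) p) :
    ContMDiffAt (𝓡 (n + 1)) 𝓘(ℝ, ℝ) ∞ (fun x ↦ g.val x (X x) (Y x)) p := by
  have : ContMDiffAt (𝓡 (n + 1)) ((𝓡 (n + 1)).prod 𝓘(ℝ, ℝ)) ∞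
      (fun m ↦ TotalSpace.mk' ℝ (E := Bundle.Trivial M ℝ) m (g.val m (X m) (Y m))) p := by
    apply ContMDiffAt.clm_bundle_apply₂ (F₁ := EuclideanSpace ℝ (Fin (n + 1)))
      (F₂ := EuclideanSpace ℝ (Fin (n + 1)))
    · exact g.contMDiff p
    · exact hX
    · exact hY
  simp only [contMDiffAt_totalSpace] at this
  exact this.2

theorem mvfderiv_congr_aux {f h : M → ℝ} {p : M} (hfh : f =ᶠ[𝓝 p] h)
    (v : TangentSpace (𝓡 (n + 1)) p) :
    mvfderiv (𝓡 (n + 1)) f p v = mvfderiv (𝓡 (n + 1)) h p v :=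
  congrArg (fun L : EuclideanSpace ℝ (Fin (n + 1)) →L[ℝ] ℝ ↦ L v)
    (hfh.mfderiv_eq (I := 𝓡 (n + 1)) (I' := 𝓘(ℝ, ℝ)))

/-- The derivative along a Lie bracket is the commutator of the derivatives. -/
theorem mvfderiv_lieBracket (ξ η : SmoothVectorField n M) {f : M → ℝ} {p : M}
    (hf : ∀ᶠ x in 𝓝 p, ContMDiffAt (𝓡 (n + 1)) 𝓘(ℝ, ℝ) ∞ f x)
    (hη : MDifferentiableAt (𝓡 (n + 1)) 𝓘(ℝ, ℝ) (fun x ↦ mvfderiv (𝓡 (n + 1)) f x (η x)) p)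
    (hξ : MDifferentiableAt (𝓡 (n + 1)) 𝓘(ℝ, ℝ) (fun x ↦ mvfderiv (𝓡 (n + 1)) f x (ξ x)) p) :
    mvfderiv (𝓡 (n + 1)) f p (mlieBracket (𝓡 (n + 1)) ξ η p) =
      mvfderiv (𝓡 (n + 1)) (fun x ↦ mvfderiv (𝓡 (n + 1)) f x (η x)) p (ξ p) -
        mvfderiv (𝓡 (n + 1)) (fun x ↦ mvfderiv (𝓡 (n + 1)) f x (ξ x)) p (η p) := by
  set I := 𝓡 (n + 1)
  let e := trivializationAt (EuclideanSpace ℝ (Fin (n + 1))) (TangentSpace I : M → Type _) p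
  let b := (EuclideanSpace.basisFun (Fin (n + 1)) ℝ).toBasis
  let W := e.localFrame b 0
  have hp : p ∈ e.baseSet := mem_baseSet_trivializationAt _ _ p
  have hWp : W p ≠ 0 := by
    simp only [W, e.localFrame_apply_of_mem_baseSet b hp]
    exact (e.basisAt b hp).ne_zero 0
  have hW : ∀ᶠ x in 𝓝 p, ContMDiffAt I I.tangent ∞ (fun x ↦ (W x : TangentBundle I M)) x := by
    filter_upwards [e.open_baseSet.mem_nhds hp] with x hx
    exact (e.contMDiffOn_localFrame_baseSet (I := I) ∞ b 0).contMDiffAt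
      (e.open_baseSet.mem_nhds hx)
  have one : (∞ : WithTop ℕ∞) ≠ 0 := by simp
  have hfW : ∀ᶠ x in 𝓝 p, ContMDiffAt I I.tangent ∞
      (fun x ↦ ((f • W) x : TangentBundle I M)) x := by
    filter_upwards [hf, hW] with x h1 h2 using h1.smul_section h2
  -- the bracket of a field with `f • W` near `p`
  have key (ζ : SmoothVectorField n M) : mlieBracket I ζ (f • W) =ᶠ[𝓝 p]
      (fun x ↦ mvfderiv I f x (ζ x)) • W + f • mlieBracket I ζ W := by
    filter_upwards [hf, hW] with x h1 h2
    exact mlieBracket_smul_right (h1.mdifferentiableAt one) (h2.mdifferentiableAt one)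
  have step (ζ θ : SmoothVectorField n M)
      (hθ : MDifferentiableAt I 𝓘(ℝ, ℝ) (fun x ↦ mvfderiv I f x (θ x)) p) :
      mlieBracket I ζ (mlieBracket I θ (f • W)) p =
      mvfderiv I (fun x ↦ mvfderiv I f x (θ x)) p (ζ p) • W p +
        mvfderiv I f p (θ p) • mlieBracket I ζ W p +
      (mvfderiv I f p (ζ p) • mlieBracket I θ W p +
        f p • mlieBracket I ζ (mlieBracket I θ W) p) := by
    have hfp := hf.self_of_nhds.mdifferentiableAt one
    have hWd := hW.self_of_nhds.mdifferentiableAt one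
    have hbr := (contMDiffAt_lieBracket_aux (θ.contMDiff p) hW.self_of_nhds).mdifferentiableAt one
    rw [(EventuallyEq.refl _ (ζ : (x : M) → TangentSpace I x)).mlieBracket_vectorField_eq (key θ),
      mlieBracket_add_right, mlieBracket_smul_right hθ hWd, mlieBracket_smul_right hfp hbr]
    · exact hθ.smul_section hWd
    · exact hfp.smul_section hbr
  have J1 := leibniz_aux (ξ.contMDiff p) (η.contMDiff p) hfW.self_of_nhds
  have J2 := leibniz_aux (ξ.contMDiff p) (η.contMDiff p) hW.self_of_nhds
  rw [step ξ η hη, step η ξ hξ, show mlieBracket I ξ η = (⁅ξ, η⁆ : SmoothVectorField n M) from rfl,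
    (key ⁅ξ, η⁆).eq_of_nhds] at J1
  rw [show mlieBracket I ξ η = (⁅ξ, η⁆ : SmoothVectorField n M) from rfl] at J2
  simp only [Pi.add_apply, Pi.smul_apply'] at J1
  erw [J2] at J1
  rw [smul_add] at J1
  have : (mvfderiv I f p (⁅ξ, η⁆ p) - (mvfderiv I (fun x ↦ mvfderiv I f x (η x)) p (ξ p) -
        mvfderiv I (fun x ↦ mvfderiv I f x (ξ x)) p (η p))) • W p = 0 := by
    simp only [sub_smul]
    rw [← sub_eq_zero] at J1
    rw [← neg_eq_zero, ← J1]
    simp only [I]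
    abel
  exact sub_eq_zero.1 ((smul_eq_zero.1 this).resolve_right hWp)

/-- The Lie algebra of Killing vectors of `g`. -/
def killingAlgebra (g : LorentzianMetric n M) : LieSubalgebra ℝ (SmoothVectorField n M) where
  carrier := {ξ | IsKilling g ξ}
  zero_mem' := by
    intro U _ X Y _ _ p _
    have h : ⇑(0 : SmoothVectorField n M) = 0 := rfl
    simp [h]
  add_mem' := by
    intro ξ η hξ hη U hU X Y hX hY p hp
    have h : ⇑(ξ + η) = ⇑ξ + ⇑η := rfl
    rw [h, mlieBracket_add_left (ξ.mdiffAt p) (η.mdiffAt p),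
      mlieBracket_add_left (ξ.mdiffAt p) (η.mdiffAt p), Pi.add_apply, map_add,
      hξ U hU X Y hX hY p hp, hη U hU X Y hX hY p hp]
    simp only [map_add, _root_.add_apply]
    ring
  smul_mem' := by
    intro c ξ hξ U hU X Y hX hY p hp
    have h : ⇑(c • ξ) = c • ⇑ξ := rfl
    rw [h, mlieBracket_const_smul_left (ξ.mdiffAt p),
      mlieBracket_const_smul_left (ξ.mdiffAt p), Pi.smul_apply, map_smul,
      hξ U hU X Y hX hY p hp]
    simp only [map_smul, _root_.smul_apply, smul_eq_mul]
    ring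
  lie_mem' := by
    intro ξ η hξ hη U hU X Y hX hY p hp
    have hXp (x) (hx : x ∈ U) := hX.contMDiffAt (hU.mem_nhds hx)
    have hYp (x) (hx : x ∈ U) := hY.contMDiffAt (hU.mem_nhds hx)
    have one : (∞ : WithTop ℕ∞) ≠ 0 := by simp
    have hB (ζ : SmoothVectorField n M) {Z : (x : M) → TangentSpace (𝓡 (n + 1)) x}
        (hZ : ContMDiffOn (𝓡 (n + 1)) (𝓡 (n + 1)).tangent ∞
          (fun x ↦ (Z x : TangentBundle (𝓡 (n + 1)) M)) U) :
        ContMDiffOn (𝓡 (n + 1)) (𝓡 (n + 1)).tangent ∞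
          (fun x ↦ (mlieBracket (𝓡 (n + 1)) ζ Z x : TangentBundle (𝓡 (n + 1)) M)) U :=
      fun x hx ↦ (contMDiffAt_lieBracket_aux (ζ.contMDiff x)
        (hZ.contMDiffAt (hU.mem_nhds hx))).contMDiffWithinAt
    have hG {Z W : (x : M) → TangentSpace (𝓡 (n + 1)) x}
        (hZ : ContMDiffOn (𝓡 (n + 1)) (𝓡 (n + 1)).tangent ∞
          (fun x ↦ (Z x : TangentBundle (𝓡 (n + 1)) M)) U)
        (hW : ContMDiffOn (𝓡 (n + 1)) (𝓡 (n + 1)).tangent ∞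
          (fun x ↦ (W x : TangentBundle (𝓡 (n + 1)) M)) U) (x : M) (hx : x ∈ U) :
        ContMDiffAt (𝓡 (n + 1)) 𝓘(ℝ, ℝ) ∞ (fun x ↦ g.val x (Z x) (W x)) x :=
      g.contMDiffAt_apply (hZ.contMDiffAt (hU.mem_nhds hx)) (hW.contMDiffAt (hU.mem_nhds hx))
    have hev (ζ : SmoothVectorField n M) (hζ : IsKilling g ζ) :
        (fun x ↦ mvfderiv (𝓡 (n + 1)) (fun x ↦ g.val x (X x) (Y x)) x (ζ x)) =ᶠ[𝓝 p]
        ((fun x ↦ g.val x (mlieBracket (𝓡 (n + 1)) ζ X x) (Y x)) +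
          fun x ↦ g.val x (X x) (mlieBracket (𝓡 (n + 1)) ζ Y x)) := by
      filter_upwards [hU.mem_nhds hp] with x hx using hζ U hU X Y hX hY x hx
    have hd1 (ζ : SmoothVectorField n M) := (hG (hB ζ hX) hY p hp).mdifferentiableAt one
    have hd2 (ζ : SmoothVectorField n M) := (hG hX (hB ζ hY) p hp).mdifferentiableAt one
    have hd (ζ : SmoothVectorField n M) (hζ : IsKilling g ζ) :=
      ((hd1 ζ).add (hd2 ζ)).congr_of_eventuallyEq (hev ζ hζ)
    have h2 (ζ θ : SmoothVectorField n M) (hζ : IsKilling g ζ) (hθ : IsKilling g θ) :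
        mvfderiv (𝓡 (n + 1))
          (fun x ↦ mvfderiv (𝓡 (n + 1)) (fun x ↦ g.val x (X x) (Y x)) x (θ x)) p (ζ p) =
        g.val p (mlieBracket (𝓡 (n + 1)) ζ (mlieBracket (𝓡 (n + 1)) θ X) p) (Y p) +
        g.val p (mlieBracket (𝓡 (n + 1)) θ X p) (mlieBracket (𝓡 (n + 1)) ζ Y p) +
        (g.val p (mlieBracket (𝓡 (n + 1)) ζ X p) (mlieBracket (𝓡 (n + 1)) θ Y p) +
        g.val p (X p) (mlieBracket (𝓡 (n + 1)) ζ (mlieBracket (𝓡 (n + 1)) θ Y) p)) := by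
      rw [← hζ U hU _ _ (hB θ hX) hY p hp, ← hζ U hU _ _ hX (hB θ hY) p hp]
      have : mvfderiv (𝓡 (n + 1))
          (fun x ↦ mvfderiv (𝓡 (n + 1)) (fun x ↦ g.val x (X x) (Y x)) x (θ x)) p =
          mvfderiv (𝓡 (n + 1)) ((fun x ↦ g.val x (mlieBracket (𝓡 (n + 1)) θ X x) (Y x)) +
            fun x ↦ g.val x (X x) (mlieBracket (𝓡 (n + 1)) θ Y x)) p := by
        ext v
        exact mvfderiv_congr_aux (hev θ hθ) v
      rw [this, mvfderiv_add (hd1 θ) (hd2 θ)]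
      rfl
    have hl (Z : (x : M) → TangentSpace (𝓡 (n + 1)) x) (hZ : ContMDiffOn (𝓡 (n + 1)) (𝓡 (n + 1)).tangent ∞
          (fun x ↦ (Z x : TangentBundle (𝓡 (n + 1)) M)) U) :=
      leibniz_aux (ξ.contMDiff p) (η.contMDiff p) (hZ.contMDiffAt (hU.mem_nhds hp))
    rw [SmoothVectorField.bracket_apply, mvfderiv_lieBracket ξ η
      (by filter_upwards [hU.mem_nhds hp] with x hx using hG hX hY x hx) (hd η hη) (hd ξ hξ),
      h2 ξ η hξ hη, h2 η ξ hη hξ, hl X hX, hl Y hY]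
    simp only [map_add, _root_.add_apply]
    change _ = g.val p (mlieBracket (𝓡 (n + 1)) (mlieBracket (𝓡 (n + 1)) ξ η) X p) (Y p) +
      g.val p (X p) (mlieBracket (𝓡 (n + 1)) (mlieBracket (𝓡 (n + 1)) ξ η) Y p)
    ring

theorem mem_killingAlgebra (g : LorentzianMetric n M) (ξ : SmoothVectorField n M) :
    ξ ∈ killingAlgebra g ↔ IsKilling g ξ := Iff.rfl

/-- `S` is a smooth embedded hypersurface (without boundary): near each of its points it is the
zero set of a smooth function with nonvanishing differential. -/
def IsSmoothHypersurface (n : ℕ) {M : Type*} [TopologicalSpace M]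
    [ChartedSpace (EuclideanSpace ℝ (Fin (n + 1))) M] (S : Set M) : Prop :=
  ∀ p ∈ S, ∃ (U : Set M) (f : M → ℝ), IsOpen U ∧ p ∈ U ∧
    ContMDiffOn (𝓡 (n + 1)) 𝓘(ℝ, ℝ) ∞ f U ∧
    (∀ q ∈ U, mvfderiv (𝓡 (n + 1)) f q ≠ 0) ∧ S ∩ U = {q ∈ U | f q = 0}

/-- The tangent space at `p` of an embedded submanifold `S`, as a subspace of `T_p M`: the vectors
annihilating every smooth function defined near `p` that vanishes on `S`. -/
def tangentSubspace (n : ℕ) {M : Type*} [TopologicalSpace M]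
    [ChartedSpace (EuclideanSpace ℝ (Fin (n + 1))) M] (S : Set M) (p : M) :
    Submodule ℝ (TangentSpace (𝓡 (n + 1)) p) where
  carrier := {v | ∀ (U : Set M) (f : M → ℝ), IsOpen U → p ∈ U →
    ContMDiffOn (𝓡 (n + 1)) 𝓘(ℝ, ℝ) ∞ f U → (∀ q ∈ S ∩ U, f q = 0) →
    mvfderiv (𝓡 (n + 1)) f p v = 0}
  zero_mem' := fun U f _ _ _ _ ↦ map_zero _
  add_mem' := fun {v w} hv hw U f h1 h2 h3 h4 ↦ by
    rw [map_add, hv U f h1 h2 h3 h4, hw U f h1 h2 h3 h4, add_zero]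
  smul_mem' := fun c v hv U f h1 h2 h3 h4 ↦ by
    rw [map_smul, hv U f h1 h2 h3 h4, smul_zero]

/-- `S` is a smooth embedded null hypersurface: the metric induced on each of its tangent spaces
is degenerate. -/
def IsNullHypersurface (g : LorentzianMetric n M) (S : Set M) : Prop :=
  IsSmoothHypersurface n S ∧
    ∀ p ∈ S, ∃ v ∈ tangentSubspace n S p, v ≠ 0 ∧ ∀ w ∈ tangentSubspace n S p, g.val p v w = 0

/-- The interior of `A` in the sense of hypersurfaces (with boundary or singular points): the
points of `A` near which `A` is a smooth embedded hypersurface without boundary. -/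
def hypersurfaceInterior (n : ℕ) {M : Type*} [TopologicalSpace M]
    [ChartedSpace (EuclideanSpace ℝ (Fin (n + 1))) M] (A : Set M) : Set M :=
  {p ∈ A | ∃ U : Set M, IsOpen U ∧ p ∈ U ∧ IsSmoothHypersurface n (A ∩ U)}

/-- `S` is a Killing horizon of the Killing vector `ξ`. It may have several connected components,
but then the interior of its closure must be connected. -/
structure IsKillingHorizon (g : LorentzianMetric n M) (ξ : killingAlgebra g) (S : Set M) :
    Prop where
  nonempty : S.Nonempty
  isNullHypersurface : IsNullHypersurface g S
  null : ∀ p ∈ S, g.val p (ξ.1 p) (ξ.1 p) = 0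
  ne_zero : ∀ p ∈ S, ξ.1 p ≠ 0
  tangent : ∀ p ∈ S, ξ.1 p ∈ tangentSubspace n S p
  connected : IsConnected S ∨ IsConnected (hypersurfaceInterior n (closure S))

/-- `H` is a multiple Killing horizon: an embedded null hypersurface whose closure is that of
Killing horizons of `m ≥ 2` linearly independent Killing vectors. -/
def IsMultipleKillingHorizon (g : LorentzianMetric n M) (H : Set M) : Prop :=
  IsNullHypersurface g H ∧
    ∃ m : ℕ, 2 ≤ m ∧ ∃ (ξ : Fin m → killingAlgebra g) (S : Fin m → Set M),
      LinearIndependent ℝ ξ ∧ ∀ i, IsKillingHorizon g (ξ i) (S i) ∧ closure H = closure (S i)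

/-- The set consisting of the zero vector and of all Killing vectors which have a Killing horizon
with the same closure as `H`. -/
def horizonKillingVectors (g : LorentzianMetric n M) (H : Set M) : Set (killingAlgebra g) :=
  {ξ | ξ = 0 ∨ ∃ S : Set M, IsKillingHorizon g ξ S ∧ closure H = closure S}

end Defs

end

/-!
Let `C` be the closure of `H` and let `I` be the set of points near which `C` is a smooth
hypersurface. The set of Killing vectors in question turns out to consist of all Killing vectors
that are *null-tangent* along `I`: at each point of `I` they lie in the radical of the metric
induced on the tangent space of `I`. This description does not mention any particular horizon, and
the condition is visibly linear.

* A hypersurface is locally closed, so a Killing horizon with closure `C` is a dense subset of `I`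
  which agrees with `I` near each of its points. On the horizon, the Killing vector is a null
  vector of a degenerate hyperplane, hence lies in its radical, because orthogonal null vectors in
  Lorentzian signature are proportional. By continuity this extends to `I`
  (`IsKillingHorizon.isNullTangent`).
* If `ξ` and `η` are null-tangent along `I` and `X` is tangent to `I`, then `g (η, X) = 0` on `I`,
  and differentiating along `ξ` gives `g ([ξ, η], X) + g (η, [ξ, X]) = 0`. Since `[ξ, X]` is tangent
  to `I`, the second term vanishes (`IsNullTangent.lie`).
* Conversely, the points of `I` where a null-tangent Killing vector `ξ ≠ 0` does not vanish form a
  Killing horizon with closure `C`, provided that they are dense in `I`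
  (`exists_isKillingHorizon_of_isNullTangent`). If they were not, `ξ` would vanish on an open piece
  of a hypersurface; the skew form `∇ξ` would there have rank at most one, hence be zero, and the
  first jet of `ξ` would vanish at a point (`eq_zero_of_eq_zero_on_hypersurface`).
* A Killing vector with vanishing first jet at a point is zero: permuting indices in the derivative
  of the Killing equation bounds the second derivative of `ξ` by its first jet, so that Gronwall's
  inequality applies in a chart (`eventually_eq_zero_of_killing`), and connectedness of the manifold
  does the rest.

The tangent space of a hypersurface is by definition the annihilator of the functions vanishing on
it. It is identified with the kernel of the differential of a defining function by means of the
Lagrange multiplier theorem (`mem_tangentSubspace_iff`).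
-/

/-! ### Derivatives along vector fields, and charts -/

section Calculus

variable {n : ℕ} {M : Type*} [TopologicalSpace M]
  [ChartedSpace (EuclideanSpace ℝ (Fin (n + 1))) M] [IsManifold (𝓡 (n + 1)) ∞ M]

/-- The derivative of a smooth function along a smooth vector field is smooth. -/
theorem ContMDiffOn.mvfderiv_apply {F : Type*} [NormedAddCommGroup F] [NormedSpace ℝ F]
    {f : M → F} {X : (x : M) → TangentSpace (𝓡 (n + 1)) x} {U : Set M} (hU : IsOpen U)
    (hf : ContMDiffOn (𝓡 (n + 1)) 𝓘(ℝ, F) ∞ f U)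
    (hX : ContMDiffOn (𝓡 (n + 1)) (𝓡 (n + 1)).tangent ∞
      (fun x ↦ (X x : TangentBundle (𝓡 (n + 1)) M)) U) :
    ContMDiffOn (𝓡 (n + 1)) 𝓘(ℝ, F) ∞ (fun x ↦ mvfderiv (𝓡 (n + 1)) f x (X x)) U := by
  have h1 := hf.contMDiffOn_tangentMapWithin (m := ∞) (by simp) hU.uniqueMDiffOn
  have h2 := (contMDiff_snd_tangentBundle_modelSpace F 𝓘(ℝ, F) (n := ∞)).comp_contMDiffOn
    (h1.comp hX (fun x hx ↦ hx))
  refine h2.congr fun x hx ↦ ?_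
  change _ = mfderivWithin (𝓡 (n + 1)) 𝓘(ℝ, F) f U x (X x)
  rw [mfderivWithin_of_isOpen hU hx]
  rfl

/-- The derivative along the Lie bracket of two locally defined fields is the commutator of the
derivatives; the bracket is computed by applying the Jacobi identity to a nonvanishing field
multiplied by the function. -/
theorem mvfderiv_mlieBracket {X Y : (x : M) → TangentSpace (𝓡 (n + 1)) x} {U : Set M}
    (hU : IsOpen U)
    (hX : ContMDiffOn (𝓡 (n + 1)) (𝓡 (n + 1)).tangent ∞
      (fun x ↦ (X x : TangentBundle (𝓡 (n + 1)) M)) U)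
    (hY : ContMDiffOn (𝓡 (n + 1)) (𝓡 (n + 1)).tangent ∞
      (fun x ↦ (Y x : TangentBundle (𝓡 (n + 1)) M)) U)
    {f : M → ℝ} (hf : ContMDiffOn (𝓡 (n + 1)) 𝓘(ℝ, ℝ) ∞ f U) {p : M} (hpU : p ∈ U) :
    mvfderiv (𝓡 (n + 1)) f p (mlieBracket (𝓡 (n + 1)) X Y p) =
      mvfderiv (𝓡 (n + 1)) (fun x ↦ mvfderiv (𝓡 (n + 1)) f x (Y x)) p (X p) -
        mvfderiv (𝓡 (n + 1)) (fun x ↦ mvfderiv (𝓡 (n + 1)) f x (X x)) p (Y p) := by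
  let e := trivializationAt (EuclideanSpace ℝ (Fin (n + 1))) (TangentSpace (𝓡 (n + 1)) : M → Type _) p
  let b := (EuclideanSpace.basisFun (Fin (n + 1)) ℝ).toBasis
  let W := e.localFrame b 0
  have hp : p ∈ e.baseSet := mem_baseSet_trivializationAt _ _ p
  have hWp : W p ≠ 0 := by
    simp only [W, e.localFrame_apply_of_mem_baseSet b hp]
    exact (e.basisAt b hp).ne_zero 0
  have hW : ∀ᶠ x in 𝓝 p, ContMDiffAt (𝓡 (n + 1)) (𝓡 (n + 1)).tangent ∞
      (fun x ↦ (W x : TangentBundle (𝓡 (n + 1)) M)) x := by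
    filter_upwards [e.open_baseSet.mem_nhds hp] with x hx
    exact (e.contMDiffOn_localFrame_baseSet (I := 𝓡 (n + 1)) ∞ b 0).contMDiffAt
      (e.open_baseSet.mem_nhds hx)
  have one : (∞ : WithTop ℕ∞) ≠ 0 := by simp
  have hUp := hU.mem_nhds hpU
  have hf' : ∀ᶠ x in 𝓝 p, ContMDiffAt (𝓡 (n + 1)) 𝓘(ℝ, ℝ) ∞ f x := by
    filter_upwards [hUp] with x hx using hf.contMDiffAt (hU.mem_nhds hx)
  have hfW : ∀ᶠ x in 𝓝 p, ContMDiffAt (𝓡 (n + 1)) (𝓡 (n + 1)).tangent ∞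
      (fun x ↦ ((f • W) x : TangentBundle (𝓡 (n + 1)) M)) x := by
    filter_upwards [hf', hW] with x h1 h2 using h1.smul_section h2
  -- the bracket of a field with `f • W` near `p`
  have key (Z : (x : M) → TangentSpace (𝓡 (n + 1)) x) : mlieBracket (𝓡 (n + 1)) Z (f • W) =ᶠ[𝓝 p]
      (fun x ↦ mvfderiv (𝓡 (n + 1)) f x (Z x)) • W + f • mlieBracket (𝓡 (n + 1)) Z W := by
    filter_upwards [hf', hW] with x h1 h2
    exact mlieBracket_smul_right (h1.mdifferentiableAt one) (h2.mdifferentiableAt one)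
  have step (Z T : (x : M) → TangentSpace (𝓡 (n + 1)) x)
      (hT : ContMDiffOn (𝓡 (n + 1)) (𝓡 (n + 1)).tangent ∞
        (fun x ↦ (T x : TangentBundle (𝓡 (n + 1)) M)) U) :
      mlieBracket (𝓡 (n + 1)) Z (mlieBracket (𝓡 (n + 1)) T (f • W)) p =
      mvfderiv (𝓡 (n + 1)) (fun x ↦ mvfderiv (𝓡 (n + 1)) f x (T x)) p (Z p) • W p +
        mvfderiv (𝓡 (n + 1)) f p (T p) • mlieBracket (𝓡 (n + 1)) Z W p +
      (mvfderiv (𝓡 (n + 1)) f p (Z p) • mlieBracket (𝓡 (n + 1)) T W p +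
        f p • mlieBracket (𝓡 (n + 1)) Z (mlieBracket (𝓡 (n + 1)) T W) p) := by
    have hθ := ((hf.mvfderiv_apply hU hT).contMDiffAt hUp).mdifferentiableAt one
    have hfp := hf'.self_of_nhds.mdifferentiableAt one
    have hWd := hW.self_of_nhds.mdifferentiableAt one
    have hbr := (contMDiffAt_lieBracket_aux (hT.contMDiffAt hUp)
      hW.self_of_nhds).mdifferentiableAt one
    rw [(EventuallyEq.refl _ Z).mlieBracket_vectorField_eq (key T),
      mlieBracket_add_right, mlieBracket_smul_right hθ hWd, mlieBracket_smul_right hfp hbr]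
    · exact hθ.smul_section hWd
    · exact hfp.smul_section hbr
  have J1 := leibniz_aux (hX.contMDiffAt hUp) (hY.contMDiffAt hUp) hfW.self_of_nhds
  have J2 := leibniz_aux (hX.contMDiffAt hUp) (hY.contMDiffAt hUp) hW.self_of_nhds
  rw [step X Y hY, step Y X hX, (key (mlieBracket (𝓡 (n + 1)) X Y)).eq_of_nhds] at J1
  simp only [Pi.add_apply, Pi.smul_apply'] at J1
  erw [J2] at J1
  rw [smul_add] at J1
  have : (mvfderiv (𝓡 (n + 1)) f p (mlieBracket (𝓡 (n + 1)) X Y p) -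
      (mvfderiv (𝓡 (n + 1)) (fun x ↦ mvfderiv (𝓡 (n + 1)) f x (Y x)) p (X p) -
        mvfderiv (𝓡 (n + 1)) (fun x ↦ mvfderiv (𝓡 (n + 1)) f x (X x)) p (Y p))) • W p = 0 := by
    simp only [sub_smul]
    rw [← sub_eq_zero] at J1
    rw [← neg_eq_zero, ← J1]
    abel
  exact sub_eq_zero.1 ((smul_eq_zero.1 this).resolve_right hWp)

end Calculus

section Chart

variable {n : ℕ} {M : Type*} [TopologicalSpace M]
  [ChartedSpace (EuclideanSpace ℝ (Fin (n + 1))) M]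

/-- The coordinate field with constant components `v` in the chart at `p`. -/
noncomputable def chartField (p : M) (v : EuclideanSpace ℝ (Fin (n + 1))) (q : M) :
    TangentSpace (𝓡 (n + 1)) q :=
  (mvfderiv (𝓡 (n + 1)) (extChartAt (𝓡 (n + 1)) p) q).inverse v

/-- The components of a vector field in the chart at `p`. -/
noncomputable def chartRep (p : M) (X : (x : M) → TangentSpace (𝓡 (n + 1)) x)
    (y : EuclideanSpace ℝ (Fin (n + 1))) : EuclideanSpace ℝ (Fin (n + 1)) :=
  mvfderiv (𝓡 (n + 1)) (extChartAt (𝓡 (n + 1)) p) ((extChartAt (𝓡 (n + 1)) p).symm y)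
    (X ((extChartAt (𝓡 (n + 1)) p).symm y))

variable [IsManifold (𝓡 (n + 1)) ∞ M]

theorem isInvertible_mvfderiv_extChartAt {p q : M} (hq : q ∈ (extChartAt (𝓡 (n + 1)) p).source) :
    (mvfderiv (𝓡 (n + 1)) (extChartAt (𝓡 (n + 1)) p) q).IsInvertible := by
  have : IsManifold (𝓡 (n + 1)) 1 M := IsManifold.of_le (n := ∞) (by simp)
  exact isInvertible_mfderiv_extChartAt hq

theorem mvfderiv_extChartAt_chartField {p q : M} (hq : q ∈ (extChartAt (𝓡 (n + 1)) p).source)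
    (v : EuclideanSpace ℝ (Fin (n + 1))) :
    mvfderiv (𝓡 (n + 1)) (extChartAt (𝓡 (n + 1)) p) q (chartField p v q) = v := by
  obtain ⟨e, he⟩ := isInvertible_mvfderiv_extChartAt hq
  rw [chartField, ← he]
  simp

theorem chartField_mvfderiv_extChartAt {p q : M} (hq : q ∈ (extChartAt (𝓡 (n + 1)) p).source)
    (w : TangentSpace (𝓡 (n + 1)) q) :
    chartField p (mvfderiv (𝓡 (n + 1)) (extChartAt (𝓡 (n + 1)) p) q w) q = w := by
  obtain ⟨e, he⟩ := isInvertible_mvfderiv_extChartAt hq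
  rw [chartField, ← he]
  simp

theorem contMDiffOn_extChartAt_source (p : M) :
    ContMDiffOn (𝓡 (n + 1)) 𝓘(ℝ, EuclideanSpace ℝ (Fin (n + 1))) ∞ (extChartAt (𝓡 (n + 1)) p)
      (extChartAt (𝓡 (n + 1)) p).source := by
  have := contMDiffOn_extChartAt (n := ∞) (I := 𝓡 (n + 1)) (x := p)
  rwa [← extChartAt_source (𝓡 (n + 1))] at this

theorem contMDiffOn_chartField (p : M) (v : EuclideanSpace ℝ (Fin (n + 1))) :
    ContMDiffOn (𝓡 (n + 1)) (𝓡 (n + 1)).tangent ∞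
      (fun x ↦ (chartField p v x : TangentBundle (𝓡 (n + 1)) M))
      (extChartAt (𝓡 (n + 1)) p).source := by
  intro q hq
  have : IsManifold (𝓡 (n + 1)) (((⊤ : ℕ∞) : WithTop ℕ∞) + 1) M := by
    have h : (((⊤ : ℕ∞) : WithTop ℕ∞) + 1) = ∞ := rfl
    rw [h]; infer_instance
  have hφ : ContMDiffAt (𝓡 (n + 1)) 𝓘(ℝ, EuclideanSpace ℝ (Fin (n + 1))) ∞
      (extChartAt (𝓡 (n + 1)) p) q :=
    (contMDiffOn_extChartAt_source p).contMDiffAt ((isOpen_extChartAt_source p).mem_nhds hq)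
  refine (ContMDiffAt.mpullback_vectorField_preimage (m := ∞) (n := ∞)
    (V := fun _ : EuclideanSpace ℝ (Fin (n + 1)) ↦ v) ?_ hφ
    (isInvertible_mvfderiv_extChartAt hq) le_rfl).contMDiffWithinAt
  exact contMDiffAt_vectorSpace_iff_contDiffAt.2 contDiffAt_const

theorem contDiffOn_comp_extChartAt_symm {F : Type*} [NormedAddCommGroup F] [NormedSpace ℝ F]
    {f : M → F} {p : M}
    (hf : ContMDiffOn (𝓡 (n + 1)) 𝓘(ℝ, F) ∞ f (extChartAt (𝓡 (n + 1)) p).source) :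
    ContDiffOn ℝ ∞ (f ∘ (extChartAt (𝓡 (n + 1)) p).symm) (extChartAt (𝓡 (n + 1)) p).target := by
  rw [← contMDiffOn_iff_contDiffOn]
  exact hf.comp (contMDiffOn_extChartAt_symm p) (fun y hy ↦ (extChartAt (𝓡 (n + 1)) p).map_target hy)

theorem contDiffOn_chartRep (p : M) (ξ : SmoothVectorField n M) :
    ContDiffOn ℝ ∞ (chartRep p ξ) (extChartAt (𝓡 (n + 1)) p).target := by
  refine contDiffOn_comp_extChartAt_symm
    (f := fun q ↦ mvfderiv (𝓡 (n + 1)) (extChartAt (𝓡 (n + 1)) p) q (ξ q)) ?_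
  exact (contMDiffOn_extChartAt_source p).mvfderiv_apply (isOpen_extChartAt_source p)
    ξ.contMDiff.contMDiffOn

/-- The chain rule for a function of the chart coordinates. -/
theorem mvfderiv_comp_extChartAt {F : Type*} [NormedAddCommGroup F] [NormedSpace ℝ F]
    {h : EuclideanSpace ℝ (Fin (n + 1)) → F} {f : M → F} {p q : M}
    (hq : q ∈ (extChartAt (𝓡 (n + 1)) p).source)
    (hh : DifferentiableAt ℝ h (extChartAt (𝓡 (n + 1)) p q))
    (hf : f =ᶠ[𝓝 q] h ∘ extChartAt (𝓡 (n + 1)) p) (w : TangentSpace (𝓡 (n + 1)) q) :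
    mvfderiv (𝓡 (n + 1)) f q w = fderiv ℝ h (extChartAt (𝓡 (n + 1)) p q)
      (mvfderiv (𝓡 (n + 1)) (extChartAt (𝓡 (n + 1)) p) q w) := by
  have : IsManifold (𝓡 (n + 1)) 1 M := IsManifold.of_le (n := ∞) (by simp)
  have h1 : MDifferentiableAt (𝓡 (n + 1)) 𝓘(ℝ, EuclideanSpace ℝ (Fin (n + 1)))
      (extChartAt (𝓡 (n + 1)) p) q := mdifferentiableAt_extChartAt (by simpa using hq)
  have h2 : HasMFDerivAt (𝓡 (n + 1)) 𝓘(ℝ, F) (h ∘ extChartAt (𝓡 (n + 1)) p) q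
      ((fderiv ℝ h (extChartAt (𝓡 (n + 1)) p q)).comp
        (mfderiv (𝓡 (n + 1)) 𝓘(ℝ, EuclideanSpace ℝ (Fin (n + 1))) (extChartAt (𝓡 (n + 1)) p) q)) :=
    HasMFDerivAt.comp q hh.hasFDerivAt.hasMFDerivAt h1.hasMFDerivAt
  change mfderiv (𝓡 (n + 1)) 𝓘(ℝ, F) f q w = _
  rw [(h2.congr_of_eventuallyEq hf).mfderiv]
  rfl

end Chart

/-! ### Hypersurfaces and their tangent spaces -/

section Hypersurface

variable {n : ℕ} {M : Type*} [TopologicalSpace M]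
  [ChartedSpace (EuclideanSpace ℝ (Fin (n + 1))) M]

theorem tangentSubspace_le_of_inter_eq {A B U : Set M} (hU : IsOpen U) {p : M} (hp : p ∈ U)
    (h : A ∩ U = B ∩ U) : tangentSubspace n A p ≤ tangentSubspace n B p := by
  intro v hv V f hV hpV hf hfB
  refine hv (V ∩ U) f (hV.inter hU) ⟨hpV, hp⟩ (hf.mono inter_subset_left) fun q hq ↦ ?_
  have : q ∈ B ∩ U := h ▸ ⟨hq.1, hq.2.2⟩
  exact hfB q ⟨this.1, hq.2.1⟩

/-- The tangent space of a set at a point depends only on the germ of the set. -/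
theorem tangentSubspace_eq_of_inter_eq {A B U : Set M} (hU : IsOpen U) {p : M} (hp : p ∈ U)
    (h : A ∩ U = B ∩ U) : tangentSubspace n A p = tangentSubspace n B p :=
  le_antisymm (tangentSubspace_le_of_inter_eq hU hp h)
    (tangentSubspace_le_of_inter_eq hU hp h.symm)

theorem isSmoothHypersurface_inter {S U : Set M} (hS : IsSmoothHypersurface n S) (hU : IsOpen U) :
    IsSmoothHypersurface n (S ∩ U) := by
  rintro p ⟨hpS, hpU⟩
  obtain ⟨V, f, hV, hpV, hf, hdf, hSV⟩ := hS p hpS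
  refine ⟨V ∩ U, f, hV.inter hU, ⟨hpV, hpU⟩, hf.mono inter_subset_left,
    fun q hq ↦ hdf q hq.1, ?_⟩
  ext q
  have := Set.ext_iff.1 hSV q
  simp only [mem_inter_iff, mem_ofPred_eq] at this ⊢
  tauto

/-- A smooth hypersurface is locally closed, so near each of its points it agrees with its
closure. -/
theorem exists_closure_inter_eq {S : Set M} (hS : IsSmoothHypersurface n S) {p : M} (hp : p ∈ S) :
    ∃ U : Set M, IsOpen U ∧ p ∈ U ∧ closure S ∩ U = S ∩ U := by
  obtain ⟨U, f, hU, hpU, hf, -, hSU⟩ := hS p hp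
  refine ⟨U, hU, hpU, Subset.antisymm ?_ (inter_subset_inter_left _ subset_closure)⟩
  rintro q ⟨hqS, hqU⟩
  rw [hSU]
  refine ⟨hqU, ?_⟩
  have hfr : ∃ᶠ x in 𝓝 q, f x = 0 := by
    refine ((mem_closure_iff_frequently.1 hqS).and_eventually (hU.mem_nhds hqU)).mono fun x hx ↦ ?_
    have : x ∈ S ∩ U := hx
    rw [hSU] at this
    exact this.2
  by_contra hne
  have hc : ContinuousAt f q := hf.continuousOn.continuousAt (hU.mem_nhds hqU)
  exact hfr (hc.eventually_ne hne)

theorem isSmoothHypersurface_hypersurfaceInterior (C : Set M) :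
    IsSmoothHypersurface n (hypersurfaceInterior n C) := by
  rintro p ⟨hpC, U, hU, hpU, hCU⟩
  obtain ⟨V, f, hV, hpV, hf, hdf, hSV⟩ := hCU p ⟨hpC, hpU⟩
  refine ⟨V ∩ U, f, hV.inter hU, ⟨hpV, hpU⟩, hf.mono inter_subset_left,
    fun q hq ↦ hdf q hq.1, ?_⟩
  ext q
  have := Set.ext_iff.1 hSV q
  simp only [mem_inter_iff, mem_ofPred_eq] at this ⊢
  constructor
  · rintro ⟨hq, hqV, hqU⟩
    exact ⟨⟨hqV, hqU⟩, (this.1 ⟨⟨hq.1, hqU⟩, hqV⟩).2⟩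
  · rintro ⟨⟨hqV, hqU⟩, hfq⟩
    exact ⟨⟨(this.2 ⟨hqV, hfq⟩).1.1, U, hU, hqU, hCU⟩, hqV, hqU⟩

theorem subset_hypersurfaceInterior_closure {S : Set M} (hS : IsSmoothHypersurface n S) :
    S ⊆ hypersurfaceInterior n (closure S) := by
  intro p hp
  obtain ⟨U, hU, hpU, h⟩ := exists_closure_inter_eq hS hp
  exact ⟨subset_closure hp, U, hU, hpU, h ▸ isSmoothHypersurface_inter hS hU⟩

theorem hypersurfaceInterior_subset (C : Set M) : hypersurfaceInterior n C ⊆ C := fun _ h ↦ h.1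

theorem tangentSubspace_hypersurfaceInterior_closure {S : Set M} (hS : IsSmoothHypersurface n S)
    {p : M} (hp : p ∈ S) :
    tangentSubspace n (hypersurfaceInterior n (closure S)) p = tangentSubspace n S p := by
  obtain ⟨U, hU, hpU, h⟩ := exists_closure_inter_eq hS hp
  refine tangentSubspace_eq_of_inter_eq hU hpU (Subset.antisymm ?_ ?_)
  · exact h ▸ inter_subset_inter_left _ (hypersurfaceInterior_subset _)
  · exact inter_subset_inter_left _ (subset_hypersurfaceInterior_closure hS)

variable [IsManifold (𝓡 (n + 1)) ∞ M]

/-- The tangent space of `{f = 0}` is the kernel of the differential of `f`: by the Lagrange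
multiplier theorem, the differential of a function vanishing on `{f = 0}` is proportional to that
of `f`. -/
theorem mem_tangentSubspace_iff {S U : Set M} {f : M → ℝ} (hU : IsOpen U)
    (hf : ContMDiffOn (𝓡 (n + 1)) 𝓘(ℝ, ℝ) ∞ f U) {p : M} (hpS : p ∈ S) (hpU : p ∈ U)
    (hdf : mvfderiv (𝓡 (n + 1)) f p ≠ 0) (hSU : S ∩ U = {q ∈ U | f q = 0})
    (v : TangentSpace (𝓡 (n + 1)) p) :
    v ∈ tangentSubspace n S p ↔ mvfderiv (𝓡 (n + 1)) f p v = 0 := by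
  constructor
  · intro hv
    refine hv U f hU hpU hf fun q hq ↦ ?_
    rw [hSU] at hq
    exact hq.2
  intro hv V h hV hpV hh hhS
  set φ := extChartAt (𝓡 (n + 1)) p with hφ
  have hpφ : p ∈ φ.source := mem_extChartAt_source p
  have key (k : M → ℝ) {W : Set M} (hW : W ∈ 𝓝 p)
      (hk : ContMDiffOn (𝓡 (n + 1)) 𝓘(ℝ, ℝ) ∞ k W) :
      HasStrictFDerivAt (k ∘ φ.symm) (fderiv ℝ (k ∘ φ.symm) (φ p)) (φ p) ∧
      ∀ w, mvfderiv (𝓡 (n + 1)) k p w = fderiv ℝ (k ∘ φ.symm) (φ p)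
        (mvfderiv (𝓡 (n + 1)) φ p w) := by
    have hc : ContDiffAt ℝ ∞ (k ∘ φ.symm) (φ p) := by
      rw [← contMDiffAt_iff_contDiffAt]
      refine ContMDiffAt.comp _ (I' := 𝓡 (n + 1)) ?_
        ((contMDiffOn_extChartAt_symm p).contMDiffAt (extChartAt_target_mem_nhds p))
      rw [hφ, extChartAt_to_inv]
      exact hk.contMDiffAt hW
    have hs := hc.hasStrictFDerivAt (by simp)
    refine ⟨hs, fun w ↦ mvfderiv_comp_extChartAt hpφ hs.hasFDerivAt.differentiableAt ?_ w⟩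
    filter_upwards [extChartAt_source_mem_nhds (I := 𝓡 (n + 1)) p] with q hq
    simp only [Function.comp_apply]
    rw [φ.left_inv hq]
  obtain ⟨hf1, hf2⟩ := key f (hU.mem_nhds hpU) hf
  obtain ⟨hh1, hh2⟩ := key h (hV.mem_nhds hpV) hh
  have hfp : f p = 0 := by
    have : p ∈ S ∩ U := ⟨hpS, hpU⟩
    rw [hSU] at this
    exact this.2
  have hext : IsLocalExtrOn (h ∘ φ.symm) {y | (f ∘ φ.symm) y = (f ∘ φ.symm) (φ p)} (φ p) := by
    left
    have hcont : Tendsto φ.symm (𝓝 (φ p)) (𝓝 p) := by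
      have := continuousAt_extChartAt_symm (I := 𝓡 (n + 1)) p
      rwa [ContinuousAt, extChartAt_to_inv] at this
    filter_upwards [self_mem_nhdsWithin,
      nhdsWithin_le_nhds (hcont (inter_mem (hU.mem_nhds hpU) (hV.mem_nhds hpV)))] with y hy hy'
    have h0 : f (φ.symm y) = 0 := by simpa [φ.left_inv hpφ, hfp] using hy
    have hyS : φ.symm y ∈ S ∩ U := hSU ▸ ⟨hy'.1, h0⟩
    simp [φ.left_inv hpφ, hhS _ ⟨hyS.1, hy'.2⟩, hhS p ⟨hpS, hpV⟩]
  obtain ⟨a, b, hab, hrel⟩ := hext.exists_multipliers_of_hasStrictFDerivAt_1d hf1 hh1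
  have hrel' (w : TangentSpace (𝓡 (n + 1)) p) :
      a * mvfderiv (𝓡 (n + 1)) f p w + b * mvfderiv (𝓡 (n + 1)) h p w = 0 := by
    rw [hf2, hh2]
    simpa using congrArg (fun L : EuclideanSpace ℝ (Fin (n + 1)) →L[ℝ] ℝ ↦
      L (mvfderiv (𝓡 (n + 1)) φ p w)) hrel
  have hb : b ≠ 0 := by
    rintro rfl
    have ha : a ≠ 0 := by simpa using hab
    refine hdf (ContinuousLinearMap.ext fun w ↦ ?_)
    simpa [ha] using hrel' w
  simpa [hv, hb] using hrel' v

/-- Every tangent vector of a hypersurface extends locally to a smooth vector field which is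
tangent to the hypersurface. -/
theorem exists_tangent_extension {S : Set M} (hS : IsSmoothHypersurface n S) {p : M} (hp : p ∈ S)
    {w : TangentSpace (𝓡 (n + 1)) p} (hw : w ∈ tangentSubspace n S p) :
    ∃ (U : Set M) (X : (x : M) → TangentSpace (𝓡 (n + 1)) x), IsOpen U ∧ p ∈ U ∧
      ContMDiffOn (𝓡 (n + 1)) (𝓡 (n + 1)).tangent ∞
        (fun x ↦ (X x : TangentBundle (𝓡 (n + 1)) M)) U ∧
      X p = w ∧ ∀ q ∈ S ∩ U, X q ∈ tangentSubspace n S q := by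
  obtain ⟨V, f, hV, hpV, hf, hdf, hSV⟩ := hS p hp
  set φ := extChartAt (𝓡 (n + 1)) p with hφ
  have hpφ : p ∈ φ.source := mem_extChartAt_source p
  obtain ⟨z, hz⟩ : ∃ z, mvfderiv (𝓡 (n + 1)) f p z = 1 := by
    obtain ⟨z, hz⟩ : ∃ z, mvfderiv (𝓡 (n + 1)) f p z ≠ 0 := by
      by_contra! h
      exact hdf p hpV (ContinuousLinearMap.ext h)
    exact ⟨(mvfderiv (𝓡 (n + 1)) f p z)⁻¹ • z, by simp [hz]⟩
  let Z := chartField p (mvfderiv (𝓡 (n + 1)) φ p z)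
  let W := chartField p (mvfderiv (𝓡 (n + 1)) φ p w)
  have hZp : Z p = z := chartField_mvfderiv_extChartAt hpφ z
  have hWp : W p = w := chartField_mvfderiv_extChartAt hpφ w
  have hO : IsOpen (V ∩ φ.source) := hV.inter (isOpen_extChartAt_source p)
  have hZ := (contMDiffOn_chartField p (mvfderiv (𝓡 (n + 1)) φ p z)).mono
    (inter_subset_right : V ∩ φ.source ⊆ φ.source)
  have hW := (contMDiffOn_chartField p (mvfderiv (𝓡 (n + 1)) φ p w)).mono
    (inter_subset_right : V ∩ φ.source ⊆ φ.source)
  have hf' := hf.mono (inter_subset_left : V ∩ φ.source ⊆ V)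
  -- the combination of `W` and `Z` that annihilates `f`
  refine ⟨V ∩ φ.source, (fun x ↦ mvfderiv (𝓡 (n + 1)) f x (Z x)) • W -
    (fun x ↦ mvfderiv (𝓡 (n + 1)) f x (W x)) • Z, hO, ⟨hpV, hpφ⟩, ?_, ?_, ?_⟩
  · exact ((hf'.mvfderiv_apply hO hZ).smul_section hW).sub_section
      ((hf'.mvfderiv_apply hO hW).smul_section hZ)
  · have hw' := (mem_tangentSubspace_iff hV hf hp hpV (hdf p hpV) hSV w).1 hw
    simp [hZp, hWp, hz, hw']
  · rintro q ⟨hqS, hqV, -⟩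
    rw [mem_tangentSubspace_iff hV hf hqS hqV (hdf q hqV) hSV]
    change mvfderiv (𝓡 (n + 1)) f q (mvfderiv (𝓡 (n + 1)) f q (Z q) • W q -
      mvfderiv (𝓡 (n + 1)) f q (W q) • Z q) = 0
    rw [map_sub, map_smul, map_smul, smul_eq_mul, smul_eq_mul, mul_comm, sub_self]

/-- The bracket of two fields tangent to a set is tangent to it. -/
theorem mlieBracket_mem_tangentSubspace {S U : Set M} (hU : IsOpen U)
    {X Y : (x : M) → TangentSpace (𝓡 (n + 1)) x}
    (hX : ContMDiffOn (𝓡 (n + 1)) (𝓡 (n + 1)).tangent ∞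
      (fun x ↦ (X x : TangentBundle (𝓡 (n + 1)) M)) U)
    (hY : ContMDiffOn (𝓡 (n + 1)) (𝓡 (n + 1)).tangent ∞
      (fun x ↦ (Y x : TangentBundle (𝓡 (n + 1)) M)) U)
    (hXS : ∀ q ∈ S ∩ U, X q ∈ tangentSubspace n S q)
    (hYS : ∀ q ∈ S ∩ U, Y q ∈ tangentSubspace n S q) {p : M} (hp : p ∈ S ∩ U) :
    mlieBracket (𝓡 (n + 1)) X Y p ∈ tangentSubspace n S p := by
  intro V f hV hpV hf hfS
  have hO := hU.inter hV
  have hX' := hX.mono (inter_subset_left : U ∩ V ⊆ U)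
  have hY' := hY.mono (inter_subset_left : U ∩ V ⊆ U)
  have hf' := hf.mono (inter_subset_right : U ∩ V ⊆ V)
  rw [mvfderiv_mlieBracket hO hX' hY' hf' ⟨hp.2, hpV⟩,
    hXS p hp (U ∩ V) _ hO ⟨hp.2, hpV⟩ (hf'.mvfderiv_apply hO hY')
      fun q hq ↦ hYS q ⟨hq.1, hq.2.1⟩ V f hV hq.2.2 hf hfS,
    hYS p hp (U ∩ V) _ hO ⟨hp.2, hpV⟩ (hf'.mvfderiv_apply hO hX')
      fun q hq ↦ hXS q ⟨hq.1, hq.2.1⟩ V f hV hq.2.2 hf hfS, sub_zero]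

/-- Tangency of a smooth vector field to a set is a closed condition. -/
theorem mem_tangentSubspace_of_mem_closure {S D : Set M} (ξ : SmoothVectorField n M)
    (hD : ∀ q ∈ D, ξ q ∈ tangentSubspace n S q) {p : M} (hp : p ∈ closure D) :
    ξ p ∈ tangentSubspace n S p := by
  intro V f hV hpV hf hfS
  by_contra hne
  have hc := (hf.mvfderiv_apply hV ξ.contMDiff.contMDiffOn).continuousOn.continuousAt
    (hV.mem_nhds hpV)
  obtain ⟨q, hqD, hq, hqV⟩ := ((mem_closure_iff_frequently.1 hp).and_eventually
    ((hc.eventually_ne hne).and (hV.mem_nhds hpV))).exists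
  exact hq (hD q hqD V f hV hqV hf hfS)

/-- Orthogonality of a smooth vector field to a hypersurface is a closed condition. -/
theorem apply_tangentSubspace_eq_zero_of_mem_closure (g : LorentzianMetric n M) {S D : Set M}
    (hS : IsSmoothHypersurface n S) (ξ : SmoothVectorField n M) (hDS : D ⊆ S)
    (hD : ∀ q ∈ D, ∀ w ∈ tangentSubspace n S q, g.val q (ξ q) w = 0) {p : M} (hpS : p ∈ S)
    (hp : p ∈ closure D) {w : TangentSpace (𝓡 (n + 1)) p} (hw : w ∈ tangentSubspace n S p) :
    g.val p (ξ p) w = 0 := by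
  obtain ⟨U, X, hU, hpU, hX, rfl, hXS⟩ := exists_tangent_extension hS hpS hw
  by_contra hne
  have hc : ContinuousAt (fun x ↦ g.val x (ξ x) (X x)) p :=
    (g.contMDiffAt_apply (ξ.contMDiff p) (hX.contMDiffAt (hU.mem_nhds hpU))).continuousAt
  obtain ⟨q, hqD, hq, hqU⟩ := ((mem_closure_iff_frequently.1 hp).and_eventually
    ((hc.eventually_ne hne).and (hU.mem_nhds hpU))).exists
  exact hq (hD q hqD _ (hXS q ⟨hDS hqD, hqU⟩))

end Hypersurface

/-! ### Uniqueness for the Killing equation in a vector space -/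

section Rigidity

set_option maxSynthPendingDepth 3

/-- A map whose derivative is bounded by a multiple of its own norm vanishes on a ball as soon as
it vanishes at the centre (Gronwall's inequality along the radii). -/
theorem eq_zero_of_norm_fderiv_le {E F : Type*} [NormedAddCommGroup E] [NormedSpace ℝ E]
    [NormedAddCommGroup F] [NormedSpace ℝ F] {J : E → F} {y₀ : E} {r K : ℝ}
    (hJ : ∀ y ∈ Metric.ball y₀ r, DifferentiableAt ℝ J y)
    (hb : ∀ y ∈ Metric.ball y₀ r, ‖fderiv ℝ J y‖ ≤ K * ‖J y‖) (h0 : J y₀ = 0) :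
    ∀ y ∈ Metric.ball y₀ r, J y = 0 := by
  intro y hy
  have hmem : ∀ t ∈ Icc (0 : ℝ) 1, y₀ + t • (y - y₀) ∈ Metric.ball y₀ r := fun t ht ↦ by
    have h0r : y₀ ∈ Metric.ball y₀ r :=
      Metric.mem_ball_self (dist_nonneg.trans_lt (Metric.mem_ball.1 hy))
    exact (convex_ball y₀ r).add_smul_sub_mem h0r hy ht
  have hd : ∀ t ∈ Icc (0 : ℝ) 1, HasDerivAt (fun t : ℝ ↦ J (y₀ + t • (y - y₀)))
      (fderiv ℝ J (y₀ + t • (y - y₀)) (y - y₀)) t := fun t ht ↦ by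
    have h1 : HasDerivAt (fun t : ℝ ↦ y₀ + t • (y - y₀)) (y - y₀) t := by
      simpa using ((hasDerivAt_id t).smul_const (y - y₀)).const_add y₀
    exact (hJ _ (hmem t ht)).hasFDerivAt.comp_hasDerivAt t h1
  have := eq_zero_of_abs_deriv_le_mul_abs_self_of_eq_zero_right (a := 0) (b := 1)
    (f := fun t : ℝ ↦ J (y₀ + t • (y - y₀))) (K := K * ‖y - y₀‖)
    (fun t ht ↦ (hd t ht).continuousAt.continuousWithinAt)
    (fun t ht ↦ (hd t (Ico_subset_Icc_self ht)).hasDerivWithinAt) (by simpa using h0)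
    (fun t ht ↦ by
      refine (ContinuousLinearMap.le_opNorm _ _).trans ?_
      have := mul_le_mul_of_nonneg_right (hb _ (hmem t (Ico_subset_Icc_self ht)))
        (norm_nonneg (y - y₀))
      linarith) 1 (by simp)
  simpa using this

variable {E : Type*} [NormedAddCommGroup E] [NormedSpace ℝ E]

/-- The derivative of the Killing equation. -/
theorem fderiv_killing_eq {G : E → E →L[ℝ] E →L[ℝ] ℝ} {ξ : E → E} {y : E}
    (hG : ContDiffAt ℝ ∞ G y) (hξ : ContDiffAt ℝ ∞ ξ y)
    (hK : ∀ᶠ z in 𝓝 y, ∀ v w, fderiv ℝ G z (ξ z) v w + G z (fderiv ℝ ξ z v) w +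
      G z v (fderiv ℝ ξ z w) = 0) (l v w : E) :
    fderiv ℝ (fderiv ℝ G) y l (ξ y) v w + fderiv ℝ G y (fderiv ℝ ξ y l) v w +
      (fderiv ℝ G y l (fderiv ℝ ξ y v) w + G y (fderiv ℝ (fderiv ℝ ξ) y l v) w) +
      (fderiv ℝ G y l v (fderiv ℝ ξ y w) + G y v (fderiv ℝ (fderiv ℝ ξ) y l w)) = 0 := by
  have one : (∞ : WithTop ℕ∞) ≠ 0 := by simp
  have hG0 := (hG.differentiableAt one).hasFDerivAt
  have hξ0 := (hξ.differentiableAt one).hasFDerivAt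
  have hG1 := ((hG.fderiv_right (m := ∞) (by simp)).differentiableAt one).hasFDerivAt
  have hξ1 := ((hξ.fderiv_right (m := ∞) (by simp)).differentiableAt one).hasFDerivAt
  have hc (u : E) : HasFDerivAt (fun _ : E ↦ u) (0 : E →L[ℝ] E) y := hasFDerivAt_const u y
  have h1 := ((hG1.clm_apply hξ0).clm_apply (hc v)).clm_apply (hc w)
  have h2 := (hG0.clm_apply (hξ1.clm_apply (hc v))).clm_apply (hc w)
  have h3 := (hG0.clm_apply (hc v)).clm_apply (hξ1.clm_apply (hc w))
  have h4 := ((h1.add h2).add h3).unique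
    ((hasFDerivAt_const (0 : ℝ) y).congr_of_eventuallyEq (hK.mono fun z hz ↦ hz v w))
  have h5 := congrArg (fun L : E →L[ℝ] ℝ ↦ L l) h4
  simp at h5
  linarith

/-- The Koszul permutation trick: a trilinear form symmetric in its first two arguments is
controlled by its symmetrization in the last two. -/
theorem abs_le_of_symm_of_abs_add_le {E : Type*} [NormedAddCommGroup E] {T : E → E → E → ℝ} {P : ℝ}
    (hs : ∀ l v w, T l v w = T v l w)
    (hT : ∀ l v w, |T l v w + T l w v| ≤ P * (‖l‖ * ‖v‖ * ‖w‖)) (l v w : E) :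
    |T l v w| ≤ 3 / 2 * P * (‖l‖ * ‖v‖ * ‖w‖) := by
  have h1 := abs_le.1 (hT l v w)
  have h2 := abs_le.1 (hT v l w)
  have h3 := abs_le.1 (hT w l v)
  rw [hs v l w] at h2
  rw [hs w l v, hs w v l] at h3
  have e1 : ‖v‖ * ‖l‖ * ‖w‖ = ‖l‖ * ‖v‖ * ‖w‖ := by ring
  have e2 : ‖w‖ * ‖l‖ * ‖v‖ = ‖l‖ * ‖v‖ * ‖w‖ := by ring
  rw [e1] at h2
  rw [e2] at h3
  rw [abs_le]
  constructor <;> linarith [h1.1, h1.2, h2.1, h2.2, h3.1, h3.2]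

/-- The second derivative of a Killing field is controlled by its first jet. -/
theorem norm_fderiv_fderiv_le_of_killing {G : E → E →L[ℝ] E →L[ℝ] ℝ} {ξ : E → E} {y : E}
    {a c : ℝ} (hc : 0 ≤ c)
    (hG : ContDiffAt ℝ ∞ G y) (hξ : ContDiffAt ℝ ∞ ξ y) (hsymm : ∀ v w, G y v w = G y w v)
    (hK : ∀ᶠ z in 𝓝 y, ∀ v w, fderiv ℝ G z (ξ z) v w + G z (fderiv ℝ ξ z v) w +
      G z v (fderiv ℝ ξ z w) = 0)
    (h1 : ‖fderiv ℝ G y‖ ≤ a) (h2 : ‖fderiv ℝ (fderiv ℝ G) y‖ ≤ a)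
    (hnd : ∀ u, ‖u‖ ≤ c * ‖G y u‖) :
    ‖fderiv ℝ (fderiv ℝ ξ) y‖ ≤ 6 * c * a * ‖(ξ y, fderiv ℝ ξ y)‖ := by
  set N := ‖(ξ y, fderiv ℝ ξ y)‖
  have hN0 : 0 ≤ N := norm_nonneg _
  have hN1 : ‖ξ y‖ ≤ N := norm_fst_le (ξ y, fderiv ℝ ξ y)
  have hN2 : ‖fderiv ℝ ξ y‖ ≤ N := norm_snd_le (ξ y, fderiv ℝ ξ y)
  have ha : 0 ≤ a := (norm_nonneg _).trans h1
  have hDξ (v : E) : ‖fderiv ℝ ξ y v‖ ≤ N * ‖v‖ :=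
    (ContinuousLinearMap.le_opNorm _ _).trans (by gcongr)
  have hDG (l v w : E) : |fderiv ℝ G y l v w| ≤ a * ‖l‖ * ‖v‖ * ‖w‖ := by
    rw [← Real.norm_eq_abs]
    exact (ContinuousLinearMap.le_opNorm₂ _ _ _).trans
      (by gcongr; exact (ContinuousLinearMap.le_opNorm _ _).trans (by gcongr))
  have hD2G (l u v w : E) : |fderiv ℝ (fderiv ℝ G) y l u v w| ≤ a * ‖l‖ * ‖u‖ * ‖v‖ * ‖w‖ := by
    rw [← Real.norm_eq_abs]
    exact (ContinuousLinearMap.le_opNorm₂ _ _ _).trans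
      (by gcongr; exact (ContinuousLinearMap.le_opNorm₂ _ _ _).trans (by gcongr))
  -- symmetry of the second derivative makes the permutation argument applicable
  have hS (l v : E) : fderiv ℝ (fderiv ℝ ξ) y l v = fderiv ℝ (fderiv ℝ ξ) y v l :=
    (hξ.isSymmSndFDerivAt (by simpa using WithTop.coe_le_coe.2 (le_top : (2 : ℕ∞) ≤ ⊤))) l v
  have key := abs_le_of_symm_of_abs_add_le
    (T := fun l v w ↦ G y (fderiv ℝ (fderiv ℝ ξ) y l v) w) (P := 4 * a * N)
    (fun l v w ↦ by rw [hS]) (fun l v w ↦ by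
      have e := fderiv_killing_eq hG hξ hK l v w
      rw [hsymm v (fderiv ℝ (fderiv ℝ ξ) y l w)] at e
      -- each of the four terms without second derivatives of `ξ` is at most `a * N`
      have b1 : |fderiv ℝ (fderiv ℝ G) y l (ξ y) v w| ≤ a * N * (‖l‖ * ‖v‖ * ‖w‖) :=
        (hD2G _ _ _ _).trans (by
          calc _ ≤ a * ‖l‖ * N * ‖v‖ * ‖w‖ := by gcongr
            _ = _ := by ring)
      have b2 : |fderiv ℝ G y (fderiv ℝ ξ y l) v w| ≤ a * N * (‖l‖ * ‖v‖ * ‖w‖) :=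
        (hDG _ _ _).trans (by
          calc _ ≤ a * (N * ‖l‖) * ‖v‖ * ‖w‖ := by gcongr; exact hDξ l
            _ = _ := by ring)
      have b3 : |fderiv ℝ G y l (fderiv ℝ ξ y v) w| ≤ a * N * (‖l‖ * ‖v‖ * ‖w‖) :=
        (hDG _ _ _).trans (by
          calc _ ≤ a * ‖l‖ * (N * ‖v‖) * ‖w‖ := by gcongr; exact hDξ v
            _ = _ := by ring)
      have b4 : |fderiv ℝ G y l v (fderiv ℝ ξ y w)| ≤ a * N * (‖l‖ * ‖v‖ * ‖w‖) :=
        (hDG _ _ _).trans (by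
          calc _ ≤ a * ‖l‖ * ‖v‖ * (N * ‖w‖) := by gcongr; exact hDξ w
            _ = _ := by ring)
      rw [abs_le] at b1 b2 b3 b4 ⊢
      constructor <;> linarith [b1.1, b1.2, b2.1, b2.2, b3.1, b3.2, b4.1, b4.2])
  refine ContinuousLinearMap.opNorm_le_bound₂ _ (by positivity) fun l v ↦ ?_
  refine (hnd _).trans ?_
  have : ‖G y (fderiv ℝ (fderiv ℝ ξ) y l v)‖ ≤ 6 * a * N * ‖l‖ * ‖v‖ := by
    refine ContinuousLinearMap.opNorm_le_bound _ (by positivity) fun w ↦ ?_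
    rw [Real.norm_eq_abs]
    exact (key l v w).trans (by linarith)
  calc _ ≤ c * (6 * a * N * ‖l‖ * ‖v‖) := by gcongr
    _ = _ := by ring

/-- A nondegenerate form on a finite-dimensional space is bounded below, uniformly for nearby
forms. -/
theorem exists_norm_le_of_nondegenerate [FiniteDimensional ℝ E] {G : E → E →L[ℝ] E →L[ℝ] ℝ}
    {y₀ : E} (hG : ContinuousAt G y₀) (hnd : ∀ u, (∀ w, G y₀ u w = 0) → u = 0) :
    ∃ c : ℝ, 0 ≤ c ∧ ∀ᶠ y in 𝓝 y₀, ∀ u, ‖u‖ ≤ c * ‖G y u‖ := by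
  obtain ⟨K, hK, hanti⟩ := (G y₀).toLinearMap.exists_antilipschitzWith
    (LinearMap.ker_eq_bot'.2 fun u hu ↦ hnd u fun w ↦ by
      simpa using congrArg (fun L : E →L[ℝ] ℝ ↦ L w) hu)
  have hb (u : E) : ‖u‖ ≤ K * ‖G y₀ u‖ := by
    simpa using hanti.le_mul_dist u 0
  have hKpos : (0 : ℝ) < K := hK
  refine ⟨2 * K, by positivity, ?_⟩
  have hε : (0 : ℝ) < 1 / (2 * K) := by positivity
  filter_upwards [hG (Metric.ball_mem_nhds (G y₀) hε)] with y hy u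
  have h1 : ‖G y₀ - G y‖ ≤ 1 / (2 * K) := by
    rw [← dist_eq_norm, dist_comm]
    exact (Metric.mem_ball.1 hy).le
  have h2 : ‖G y₀ u‖ ≤ ‖G y u‖ + 1 / (2 * K) * ‖u‖ := by
    have h3 : ‖(G y₀ - G y) u‖ ≤ 1 / (2 * K) * ‖u‖ :=
      (ContinuousLinearMap.le_opNorm _ _).trans (by gcongr)
    have h4 : G y₀ u = G y u + (G y₀ - G y) u := by simp
    rw [h4]
    exact (norm_add_le _ _).trans (by linarith)
  have h5 : K * ‖G y₀ u‖ ≤ K * ‖G y u‖ + 1 / 2 * ‖u‖ := by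
    calc _ ≤ K * (‖G y u‖ + 1 / (2 * K) * ‖u‖) := by gcongr
      _ = _ := by field_simp
  linarith [hb u]

set_option synthInstance.maxHeartbeats 200000 in
/-- A solution of the Killing equation whose first jet vanishes at a point vanishes near it. -/
theorem eventually_eq_zero_of_killing [FiniteDimensional ℝ E] {G : E → E →L[ℝ] E →L[ℝ] ℝ}
    {ξ : E → E} {Ω : Set E} (hΩ : IsOpen Ω) (hG : ContDiffOn ℝ ∞ G Ω) (hξ : ContDiffOn ℝ ∞ ξ Ω)
    (hsymm : ∀ y ∈ Ω, ∀ v w, G y v w = G y w v)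
    (hK : ∀ y ∈ Ω, ∀ v w, fderiv ℝ G y (ξ y) v w + G y (fderiv ℝ ξ y v) w +
      G y v (fderiv ℝ ξ y w) = 0) {y₀ : E} (hy₀ : y₀ ∈ Ω)
    (hnd : ∀ u, (∀ w, G y₀ u w = 0) → u = 0) (h0 : ξ y₀ = 0) (h1 : fderiv ℝ ξ y₀ = 0) :
    ∀ᶠ y in 𝓝 y₀, ξ y = 0 := by
  have one : (∞ : WithTop ℕ∞) ≠ 0 := by simp
  have hGat (y) (hy : y ∈ Ω) : ContDiffAt ℝ ∞ G y := hG.contDiffAt (hΩ.mem_nhds hy)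
  have hξat (y) (hy : y ∈ Ω) : ContDiffAt ℝ ∞ ξ y := hξ.contDiffAt (hΩ.mem_nhds hy)
  have hG1 := (hGat y₀ hy₀).fderiv_right (m := ∞) (by simp)
  have hG2 := hG1.fderiv_right (m := ∞) (by simp)
  obtain ⟨c, hc, hcy⟩ := exists_norm_le_of_nondegenerate (hGat y₀ hy₀).continuousAt hnd
  set a := max ‖fderiv ℝ G y₀‖ ‖fderiv ℝ (fderiv ℝ G) y₀‖ + 1
  have e1 : ∀ᶠ y in 𝓝 y₀, ‖fderiv ℝ G y‖ < a :=
    hG1.continuousAt.norm.eventually_lt_const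
      ((le_max_left _ _).trans_lt (lt_add_one _))
  have e2 : ∀ᶠ y in 𝓝 y₀, ‖fderiv ℝ (fderiv ℝ G) y‖ < a :=
    hG2.continuousAt.norm.eventually_lt_const
      ((le_max_right _ _).trans_lt (lt_add_one _))
  obtain ⟨r, hr, hball⟩ := Metric.eventually_nhds_iff_ball.1
    (((hΩ.eventually_mem hy₀).and hcy).and (e1.and e2))
  have hJ (y) (hy : y ∈ Ω) : HasFDerivAt (fun y ↦ (ξ y, fderiv ℝ ξ y))
      ((fderiv ℝ ξ y).prod (fderiv ℝ (fderiv ℝ ξ) y)) y :=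
    ((hξat y hy).differentiableAt one).hasFDerivAt.prodMk
      (((hξat y hy).fderiv_right (m := ∞) (by simp)).differentiableAt one).hasFDerivAt
  have hzero := eq_zero_of_norm_fderiv_le (J := fun y ↦ (ξ y, fderiv ℝ ξ y)) (y₀ := y₀) (r := r)
    (K := max 1 (6 * c * a)) (fun y hy ↦ (hJ y (hball y hy).1.1).differentiableAt)
    (fun y hy ↦ by
      obtain ⟨⟨hyΩ, hcy⟩, hy1, hy2⟩ := hball y hy
      have hD2 := norm_fderiv_fderiv_le_of_killing hc (hGat y hyΩ) (hξat y hyΩ) (hsymm y hyΩ)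
        (by filter_upwards [hΩ.mem_nhds hyΩ] with z hz using hK z hz) hy1.le hy2.le hcy
      have hD1 : ‖fderiv ℝ ξ y‖ ≤ ‖(ξ y, fderiv ℝ ξ y)‖ := norm_snd_le (ξ y, fderiv ℝ ξ y)
      rw [(hJ y hyΩ).fderiv]
      rw [ContinuousLinearMap.opNorm_prod]
      refine norm_prod_le_iff.2 ⟨hD1.trans ?_, hD2.trans ?_⟩
      · exact le_mul_of_one_le_left (norm_nonneg _) (le_max_left _ _)
      · exact mul_le_mul_of_nonneg_right (le_max_right _ _) (norm_nonneg _))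
    (by simp [h0, h1])
  filter_upwards [Metric.ball_mem_nhds y₀ hr] with y hy
  exact (Prod.ext_iff.1 (hzero y hy)).1

end Rigidity

/-! ### Rigidity of Killing vectors -/

section KillingChart

set_option maxSynthPendingDepth 3

variable {n : ℕ} {M : Type*} [TopologicalSpace M]
  [ChartedSpace (EuclideanSpace ℝ (Fin (n + 1))) M] [IsManifold (𝓡 (n + 1)) ∞ M]

/-- The components of the metric in the chart at `p`. -/
noncomputable def LorentzianMetric.chartRep (g : LorentzianMetric n M) (p : M)
    (y : EuclideanSpace ℝ (Fin (n + 1))) :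
    EuclideanSpace ℝ (Fin (n + 1)) →L[ℝ] EuclideanSpace ℝ (Fin (n + 1)) →L[ℝ] ℝ :=
  let A : EuclideanSpace ℝ (Fin (n + 1)) →L[ℝ] EuclideanSpace ℝ (Fin (n + 1)) :=
    (mvfderiv (𝓡 (n + 1)) (extChartAt (𝓡 (n + 1)) p) ((extChartAt (𝓡 (n + 1)) p).symm y)).inverse
  let B : EuclideanSpace ℝ (Fin (n + 1)) →L[ℝ] EuclideanSpace ℝ (Fin (n + 1)) →L[ℝ] ℝ :=
    g.val ((extChartAt (𝓡 (n + 1)) p).symm y)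
  B.bilinearComp A A

theorem LorentzianMetric.chartRep_apply (g : LorentzianMetric n M) (p : M)
    (y v w : EuclideanSpace ℝ (Fin (n + 1))) :
    g.chartRep p y v w = g.val ((extChartAt (𝓡 (n + 1)) p).symm y)
      (chartField p v ((extChartAt (𝓡 (n + 1)) p).symm y))
      (chartField p w ((extChartAt (𝓡 (n + 1)) p).symm y)) := rfl

theorem LorentzianMetric.contDiffOn_chartRep (g : LorentzianMetric n M) (p : M) :
    ContDiffOn ℝ ∞ (g.chartRep p) (extChartAt (𝓡 (n + 1)) p).target := by
  rw [contDiffOn_clm_apply]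
  intro v
  rw [contDiffOn_clm_apply]
  intro w
  refine contDiffOn_comp_extChartAt_symm
    (f := fun q ↦ g.val q (chartField p v q) (chartField p w q)) fun q hq ↦ ?_
  have hU := (isOpen_extChartAt_source (I := 𝓡 (n + 1)) p).mem_nhds hq
  exact (g.contMDiffAt_apply ((contMDiffOn_chartField p v).contMDiffAt hU)
    ((contMDiffOn_chartField p w).contMDiffAt hU)).contMDiffWithinAt

theorem LorentzianMetric.nondegenerate (g : LorentzianMetric n M) (p : M)
    {v : TangentSpace (𝓡 (n + 1)) p} (hv : ∀ w, g.val p v w = 0) : v = 0 := by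
  obtain ⟨t, -, ht⟩ := g.signature p
  by_contra hne
  exact (ht v (by rw [g.symm, hv]) hne).ne' (hv v)

theorem LorentzianMetric.chartRep_nondegenerate (g : LorentzianMetric n M) {p : M}
    {y : EuclideanSpace ℝ (Fin (n + 1))} (hy : y ∈ (extChartAt (𝓡 (n + 1)) p).target)
    {u : EuclideanSpace ℝ (Fin (n + 1))} (hu : ∀ w, g.chartRep p y u w = 0) : u = 0 := by
  have hq := (extChartAt (𝓡 (n + 1)) p).map_target hy
  have hz := g.nondegenerate _ (v := chartField p u ((extChartAt (𝓡 (n + 1)) p).symm y)) fun w ↦ by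
    have := hu (mvfderiv (𝓡 (n + 1)) (extChartAt (𝓡 (n + 1)) p) _ w)
    rwa [g.chartRep_apply, chartField_mvfderiv_extChartAt hq] at this
  rw [← mvfderiv_extChartAt_chartField hq u, hz, map_zero]

/-- The bracket with a coordinate field is minus the partial derivative of the components. -/
theorem mlieBracket_chartField (ξ : SmoothVectorField n M) {p q : M}
    (hq : q ∈ (extChartAt (𝓡 (n + 1)) p).source) (v : EuclideanSpace ℝ (Fin (n + 1))) :
    mlieBracket (𝓡 (n + 1)) ξ (chartField p v) q =
      chartField p (-fderiv ℝ (chartRep p ξ) (extChartAt (𝓡 (n + 1)) p q) v) q := by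
  set φ := extChartAt (𝓡 (n + 1)) p with hφ
  have hO : IsOpen φ.source := isOpen_extChartAt_source p
  have one : (∞ : WithTop ℕ∞) ≠ 0 := by simp
  rw [← chartField_mvfderiv_extChartAt hq (mlieBracket (𝓡 (n + 1)) ξ (chartField p v) q)]
  congr 1
  ext i
  let ℓ : EuclideanSpace ℝ (Fin (n + 1)) →L[ℝ] ℝ := EuclideanSpace.proj i
  have hℓφ : ContMDiffOn (𝓡 (n + 1)) 𝓘(ℝ, ℝ) ∞ (ℓ ∘ φ) φ.source :=
    ℓ.contMDiff.comp_contMDiffOn (contMDiffOn_extChartAt_source p)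
  have hd (x) (hx : x ∈ φ.source) (w : TangentSpace (𝓡 (n + 1)) x) :
      mvfderiv (𝓡 (n + 1)) (ℓ ∘ φ) x w = ℓ (mvfderiv (𝓡 (n + 1)) φ x w) := by
    rw [mvfderiv_comp_extChartAt hx ℓ.differentiableAt (EventuallyEq.refl _ _), ℓ.fderiv]
  have hbr := mvfderiv_mlieBracket hO ξ.contMDiff.contMDiffOn (contMDiffOn_chartField p v) hℓφ hq
  rw [hd q hq] at hbr
  -- the components of a coordinate field are constant
  have h1 : mvfderiv (𝓡 (n + 1))
      (fun x ↦ mvfderiv (𝓡 (n + 1)) (ℓ ∘ φ) x (chartField p v x)) q (ξ q) = 0 := by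
    rw [mvfderiv_congr_aux (h := fun _ ↦ ℓ v)]
    · simp [mvfderiv_const]
    · filter_upwards [hO.mem_nhds hq] with x hx
      rw [hd x hx, mvfderiv_extChartAt_chartField hx]
  have hξd : DifferentiableAt ℝ (chartRep p ξ) (φ q) :=
    ((contDiffOn_chartRep p ξ).contDiffAt
      ((isOpen_extChartAt_target p).mem_nhds (φ.map_source hq))).differentiableAt one
  have h2 : mvfderiv (𝓡 (n + 1))
      (fun x ↦ mvfderiv (𝓡 (n + 1)) (ℓ ∘ φ) x (ξ x)) q (chartField p v q) =
      ℓ (fderiv ℝ (chartRep p ξ) (φ q) v) := by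
    rw [mvfderiv_comp_extChartAt (h := ℓ ∘ chartRep p ξ) hq
      (ℓ.differentiableAt.comp _ hξd), mvfderiv_extChartAt_chartField hq,
      fderiv_comp _ ℓ.differentiableAt hξd, ℓ.fderiv]
    · rfl
    · filter_upwards [hO.mem_nhds hq] with x hx
      rw [hd x hx]
      simp only [Function.comp_apply, chartRep]
      rw [φ.left_inv hx]
  rw [h1, h2, zero_sub] at hbr
  change ℓ _ = ℓ (-_)
  rw [map_neg]
  exact hbr

/-- The Killing equation in the chart at `p`. -/
theorem killing_chartRep {g : LorentzianMetric n M} {ξ : SmoothVectorField n M}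
    (hξ : IsKilling g ξ) (p : M) {y : EuclideanSpace ℝ (Fin (n + 1))}
    (hy : y ∈ (extChartAt (𝓡 (n + 1)) p).target) (v w : EuclideanSpace ℝ (Fin (n + 1))) :
    fderiv ℝ (g.chartRep p) y (chartRep p ξ y) v w +
      g.chartRep p y (fderiv ℝ (chartRep p ξ) y v) w +
      g.chartRep p y v (fderiv ℝ (chartRep p ξ) y w) = 0 := by
  set φ := extChartAt (𝓡 (n + 1)) p with hφ
  have hO : IsOpen φ.source := isOpen_extChartAt_source p
  have hq : φ.symm y ∈ φ.source := φ.map_target hy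
  have hφq : φ (φ.symm y) = y := φ.right_inv hy
  have h := hξ φ.source hO _ _ (contMDiffOn_chartField p v) (contMDiffOn_chartField p w) _ hq
  have hG : DifferentiableAt ℝ (g.chartRep p) y :=
    ((g.contDiffOn_chartRep p).contDiffAt
      ((isOpen_extChartAt_target p).mem_nhds hy)).differentiableAt (by simp)
  have hG' : HasFDerivAt (fun z ↦ g.chartRep p z v w)
      (((fderiv ℝ (g.chartRep p) y).flip v).flip w) y := by
    have hc (u : EuclideanSpace ℝ (Fin (n + 1))) := hasFDerivAt_const (𝕜 := ℝ) u y
    simpa using (hG.hasFDerivAt.clm_apply (hc v)).clm_apply (hc w)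
  rw [mvfderiv_comp_extChartAt (h := fun z ↦ g.chartRep p z v w) hq
    (by rw [← hφ, hφq]; exact hG'.differentiableAt), mlieBracket_chartField ξ hq,
    mlieBracket_chartField ξ hq, ← hφ, hφq, hG'.fderiv] at h
  · change fderiv ℝ (g.chartRep p) y (chartRep p ξ y) v w =
      g.chartRep p y (-fderiv ℝ (chartRep p ξ) y v) w +
      g.chartRep p y v (-fderiv ℝ (chartRep p ξ) y w) at h
    rw [map_neg, map_neg, _root_.neg_apply] at h
    linarith
  · filter_upwards [hO.mem_nhds hq] with x hx
    simp only [Function.comp_apply, g.chartRep_apply]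
    rw [← hφ, φ.left_inv hx]

theorem chartRep_eq_zero_iff (ξ : SmoothVectorField n M) {p : M}
    {y : EuclideanSpace ℝ (Fin (n + 1))} (hy : y ∈ (extChartAt (𝓡 (n + 1)) p).target) :
    chartRep p ξ y = 0 ↔ ξ ((extChartAt (𝓡 (n + 1)) p).symm y) = 0 := by
  obtain ⟨e, he⟩ := isInvertible_mvfderiv_extChartAt ((extChartAt (𝓡 (n + 1)) p).map_target hy)
  rw [chartRep, ← he]
  exact e.map_eq_zero_iff

/-- A Killing vector whose first jet vanishes at a point vanishes near that point. -/
theorem eventually_eq_zero_of_firstJet {g : LorentzianMetric n M} {ξ : SmoothVectorField n M}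
    (hξ : IsKilling g ξ) {p : M}
    (h0 : chartRep p ξ (extChartAt (𝓡 (n + 1)) p p) = 0)
    (h1 : fderiv ℝ (chartRep p ξ) (extChartAt (𝓡 (n + 1)) p p) = 0) :
    ∀ᶠ q in 𝓝 p, ξ q = 0 := by
  set φ := extChartAt (𝓡 (n + 1)) p with hφ
  have hO : IsOpen φ.source := isOpen_extChartAt_source p
  have hp : p ∈ φ.source := mem_extChartAt_source p
  have h := eventually_eq_zero_of_killing (isOpen_extChartAt_target p) (g.contDiffOn_chartRep p)
    (contDiffOn_chartRep p ξ) (fun y _ v w ↦ g.symm _ _ _)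
    (fun y hy v w ↦ killing_chartRep hξ p hy v w) (φ.map_source hp)
    (fun u hu ↦ g.chartRep_nondegenerate (φ.map_source hp) hu) h0 h1
  filter_upwards [(continuousAt_extChartAt (I := 𝓡 (n + 1)) p).eventually h,
    hO.mem_nhds hp] with q hq hqs
  rwa [chartRep_eq_zero_iff ξ (φ.map_source hqs), ← hφ, φ.left_inv hqs] at hq

/-- On a connected manifold, a Killing vector vanishing on a non-empty open set is zero. -/
theorem eq_zero_of_eventually_eq_zero [ConnectedSpace M] {g : LorentzianMetric n M}
    {ξ : SmoothVectorField n M} (hξ : IsKilling g ξ) {p : M} (hp : ∀ᶠ q in 𝓝 p, ξ q = 0) :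
    ξ = 0 := by
  have hopen : IsOpen {p : M | ∀ᶠ q in 𝓝 p, ξ q = 0} := isOpen_setOfPred_eventually_nhds
  have hclosed : IsClosed {p : M | ∀ᶠ q in 𝓝 p, ξ q = 0} := by
    refine isClosed_of_closure_subset fun x hx ↦ ?_
    set φ := extChartAt (𝓡 (n + 1)) x with hφ
    have hxs : x ∈ φ.source := mem_extChartAt_source x
    have hO : IsOpen φ.source := isOpen_extChartAt_source x
    have hC : ContDiffAt ℝ ∞ (chartRep x ξ) (φ x) := (contDiffOn_chartRep x ξ).contDiffAt
      ((isOpen_extChartAt_target x).mem_nhds (φ.map_source hxs))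
    have hcont : ContinuousAt φ x := continuousAt_extChartAt x
    -- the first jet of `ξ` vanishes at points near which `ξ` vanishes
    have hfreq : ∃ᶠ q in 𝓝 x, chartRep x ξ (φ q) = 0 ∧ fderiv ℝ (chartRep x ξ) (φ q) = 0 := by
      refine ((mem_closure_iff_frequently.1 hx).and_eventually (hO.mem_nhds hxs)).mono
        fun q ⟨hq, hqs⟩ ↦ ?_
      have hsymm : Tendsto φ.symm (𝓝 (φ q)) (𝓝 q) := by
        have := continuousAt_extChartAt_symm' (I := 𝓡 (n + 1)) hqs
        rwa [ContinuousAt, ← hφ, φ.left_inv hqs] at this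
      have hev : chartRep x ξ =ᶠ[𝓝 (φ q)] fun _ ↦ 0 := by
        filter_upwards [hsymm.eventually hq,
          (isOpen_extChartAt_target x).mem_nhds (φ.map_source hqs)] with y hy hyt
        exact (chartRep_eq_zero_iff ξ hyt).2 hy
      exact ⟨hev.eq_of_nhds, by rw [hev.fderiv_eq]; simp⟩
    refine eventually_eq_zero_of_firstJet hξ ?_ ?_
    · by_contra hne
      obtain ⟨q, hq, hq'⟩ := (hfreq.and_eventually
        ((hC.continuousAt.comp hcont).eventually_ne hne)).exists
      exact hq' hq.1
    · by_contra hne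
      obtain ⟨q, hq, hq'⟩ := (hfreq.and_eventually
        (((hC.fderiv_right (m := ∞) (by simp)).continuousAt.comp hcont).eventually_ne hne)).exists
      exact hq' hq.2
  have huniv := IsClopen.eq_univ ⟨hclosed, hopen⟩ ⟨p, hp⟩
  ext1 q
  have hq : q ∈ {p : M | ∀ᶠ q in 𝓝 p, ξ q = 0} := huniv ▸ mem_univ q
  exact hq.self_of_nhds

/-- A Killing vector vanishing on an open piece of a hypersurface is zero: its covariant
derivative there is a skew form whose kernel contains the tangent hyperplane, so it has rank at
most one and hence vanishes. -/
theorem eq_zero_of_eq_zero_on_hypersurface [ConnectedSpace M] {g : LorentzianMetric n M}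
    {ξ : SmoothVectorField n M} (hξ : IsKilling g ξ) {S U : Set M}
    (hS : IsSmoothHypersurface n S) (hU : IsOpen U) {p : M} (hp : p ∈ S ∩ U)
    (h0 : ∀ q ∈ S ∩ U, ξ q = 0) : ξ = 0 := by
  set φ := extChartAt (𝓡 (n + 1)) p with hφ
  have hO : IsOpen φ.source := isOpen_extChartAt_source p
  have hpφ : p ∈ φ.source := mem_extChartAt_source p
  have hyt : φ p ∈ φ.target := φ.map_source hpφ
  have hC : ContDiffAt ℝ ∞ (chartRep p ξ) (φ p) := (contDiffOn_chartRep p ξ).contDiffAt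
    ((isOpen_extChartAt_target p).mem_nhds hyt)
  have hrep : chartRep p ξ (φ p) = 0 := by
    rw [chartRep_eq_zero_iff ξ hyt, ← hφ, φ.left_inv hpφ]
    exact h0 p hp
  refine eq_zero_of_eventually_eq_zero hξ (eventually_eq_zero_of_firstJet hξ hrep ?_)
  set D := fderiv ℝ (chartRep p ξ) (φ p) with hD
  set G := g.chartRep p (φ p) with hG
  have hskew (v w) : G (D v) w + G v (D w) = 0 := by
    simpa [hrep] using killing_chartRep hξ p hyt v w
  have hsymm (v w) : G v w = G w v := g.symm _ _ _
  -- the components of `ξ` vanish along `S`, so tangent vectors annihilate them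
  have hker (w) (hw : w ∈ tangentSubspace n S p) : D (mvfderiv (𝓡 (n + 1)) φ p w) = 0 := by
    ext i
    let ℓ : EuclideanSpace ℝ (Fin (n + 1)) →L[ℝ] ℝ := EuclideanSpace.proj i
    have h1 := hw (U ∩ φ.source) (fun x ↦ ℓ (mvfderiv (𝓡 (n + 1)) φ x (ξ x))) (hU.inter hO)
      ⟨hp.2, hpφ⟩ (ℓ.contMDiff.comp_contMDiffOn
        (((contMDiffOn_extChartAt_source p).mvfderiv_apply hO ξ.contMDiff.contMDiffOn).mono
          inter_subset_right))
      (fun q hq ↦ by simp [h0 q ⟨hq.1, hq.2.1⟩])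
    rw [mvfderiv_comp_extChartAt (h := ℓ ∘ chartRep p ξ) hpφ
      (ℓ.differentiableAt.comp _ (hC.differentiableAt (by simp))),
      fderiv_comp _ ℓ.differentiableAt (hC.differentiableAt (by simp)), ℓ.fderiv] at h1
    · exact h1
    · filter_upwards [hO.mem_nhds hpφ] with x hx
      simp only [Function.comp_apply, chartRep]
      rw [← hφ, φ.left_inv hx]
  obtain ⟨V, f, hV, hpV, hf, hdf, hSV⟩ := hS p hp.1
  obtain ⟨z, hz⟩ : ∃ z, mvfderiv (𝓡 (n + 1)) f p z ≠ 0 := by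
    by_contra! h
    exact hdf p hpV (ContinuousLinearMap.ext h)
  set Z := mvfderiv (𝓡 (n + 1)) φ p z with hZ
  -- modulo the tangent hyperplane every vector is a multiple of `Z`
  have hdecomp (v) : ∃ c : ℝ, D (v - c • Z) = 0 := by
    refine ⟨mvfderiv (𝓡 (n + 1)) f p (chartField p v p) / mvfderiv (𝓡 (n + 1)) f p z, ?_⟩
    have h := hker (chartField p v p -
      (mvfderiv (𝓡 (n + 1)) f p (chartField p v p) / mvfderiv (𝓡 (n + 1)) f p z) • z) (by
        rw [mem_tangentSubspace_iff hV hf hp.1 hpV (hdf p hpV) hSV]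
        rw [map_sub, map_smul, smul_eq_mul, div_mul_cancel₀ _ hz, sub_self])
    rwa [map_sub, map_smul, mvfderiv_extChartAt_chartField hpφ] at h
  have hDZ : D Z = 0 := g.chartRep_nondegenerate hyt fun w ↦ by
    rw [← hG]
    obtain ⟨c, hc⟩ := hdecomp w
    have h1 : D w = c • D Z := by
      rwa [map_sub, map_smul, sub_eq_zero] at hc
    have h2 := hskew Z Z
    have h3 := hskew Z w
    rw [hsymm Z (D Z)] at h2
    rw [h1, map_smul, hsymm Z (D Z), smul_eq_mul] at h3
    have h4 : G (D Z) Z = 0 := by linarith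
    rwa [h4, mul_zero, add_zero] at h3
  ext1 v
  obtain ⟨c, hc⟩ := hdecomp v
  rwa [map_sub, map_smul, hDZ, smul_zero, sub_zero] at hc

end KillingChart

/-! ### Null-tangent Killing vectors and horizons -/

section Horizon

variable {n : ℕ} {M : Type*} [TopologicalSpace M]
  [ChartedSpace (EuclideanSpace ℝ (Fin (n + 1))) M] [IsManifold (𝓡 (n + 1)) ∞ M]

/-- Two orthogonal null vectors in Lorentzian signature are proportional; hence a null vector of a
degenerate subspace is orthogonal to the whole subspace. -/
theorem LorentzianMetric.apply_eq_zero_of_null (g : LorentzianMetric n M) {p : M}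
    {T : Submodule ℝ (TangentSpace (𝓡 (n + 1)) p)} {v u : TangentSpace (𝓡 (n + 1)) p}
    (hvT : v ∈ T) (hv0 : v ≠ 0) (hv : ∀ w ∈ T, g.val p v w = 0) (huT : u ∈ T)
    (hu : g.val p u u = 0) : ∀ w ∈ T, g.val p u w = 0 := by
  obtain ⟨t, -, ht⟩ := g.signature p
  have htv : g.val p t v ≠ 0 := fun h ↦ (ht v h hv0).ne' (hv v hvT)
  set a := g.val p t u / g.val p t v
  -- `u - a v` is null and orthogonal to the timelike vector `t`
  have h1 : g.val p t (u - a • v) = 0 := by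
    rw [map_sub, map_smul, smul_eq_mul, div_mul_cancel₀ _ htv, sub_self]
  have h2 : g.val p (u - a • v) (u - a • v) = 0 := by
    have e1 : g.val p v u = 0 := hv u huT
    have e2 : g.val p u v = 0 := by rw [g.symm, e1]
    simp [e1, e2, hu, hv v hvT]
  have h3 : u = a • v := by
    by_contra hne
    exact (ht _ h1 (sub_ne_zero.2 hne)).ne' h2
  intro w hw
  simp [h3, hv w hw]

/-- A vector field is null-tangent along `S` if at each point of `S` it lies in the radical of the
metric induced on the tangent space of `S`. -/
def IsNullTangent (g : LorentzianMetric n M) (S : Set M) (ξ : SmoothVectorField n M) : Prop :=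
  ∀ p ∈ S, ξ p ∈ tangentSubspace n S p ∧ ∀ w ∈ tangentSubspace n S p, g.val p (ξ p) w = 0

/-- If `η` and `ξ` are null-tangent along `S` and `X` is a field tangent to `S`, then
differentiating `g (η, X) = 0` along `ξ` gives `g ([ξ, η], X) = - g (η, [ξ, X]) = 0`. -/
theorem IsNullTangent.lie {g : LorentzianMetric n M} {S : Set M} (hS : IsSmoothHypersurface n S)
    {ξ η : SmoothVectorField n M} (hK : IsKilling g ξ) (hξ : IsNullTangent g S ξ)
    (hη : IsNullTangent g S η) : IsNullTangent g S ⁅ξ, η⁆ := by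
  intro p hp
  refine ⟨?_, fun w hw ↦ ?_⟩
  · exact mlieBracket_mem_tangentSubspace isOpen_univ ξ.contMDiff.contMDiffOn
      η.contMDiff.contMDiffOn (fun q hq ↦ (hξ q hq.1).1) (fun q hq ↦ (hη q hq.1).1) ⟨hp, mem_univ p⟩
  · obtain ⟨U, X, hU, hpU, hX, rfl, hXS⟩ := exists_tangent_extension hS hp hw
    have h1 := hK U hU η X η.contMDiff.contMDiffOn hX p hpU
    have h2 : mvfderiv (𝓡 (n + 1)) (fun x ↦ g.val x (η x) (X x)) p (ξ p) = 0 := by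
      refine (hξ p hp).1 U _ hU hpU (fun q hq ↦ ?_) fun q hq ↦ (hη q hq.1).2 _ (hXS q hq)
      exact (g.contMDiffAt_apply (η.contMDiff q)
        (hX.contMDiffAt (hU.mem_nhds hq))).contMDiffWithinAt
    have h3 := (hη p hp).2 _ (mlieBracket_mem_tangentSubspace hU ξ.contMDiff.contMDiffOn hX
      (fun q hq ↦ (hξ q hq.1).1) hXS ⟨hp, hpU⟩)
    rw [h2, h3, add_zero] at h1
    exact h1.symm

/-- A Killing vector with a horizon `S` is null-tangent along the hypersurface interior of
`closure S`, since it is so on the dense subset `S`. -/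
theorem IsKillingHorizon.isNullTangent {g : LorentzianMetric n M} {ξ : killingAlgebra g}
    {S : Set M} (h : IsKillingHorizon g ξ S) :
    IsNullTangent g (hypersurfaceInterior n (closure S)) ξ.1 := by
  have hS := h.isNullHypersurface.1
  have hI := isSmoothHypersurface_hypersurfaceInterior (n := n) (closure S)
  have hSI := subset_hypersurfaceInterior_closure hS
  have h1 : ∀ q ∈ S, ξ.1 q ∈ tangentSubspace n (hypersurfaceInterior n (closure S)) q := by
    intro q hq
    rw [tangentSubspace_hypersurfaceInterior_closure hS hq]
    exact h.tangent q hq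
  have h2 : ∀ q ∈ S, ∀ w ∈ tangentSubspace n (hypersurfaceInterior n (closure S)) q,
      g.val q (ξ.1 q) w = 0 := by
    intro q hq
    rw [tangentSubspace_hypersurfaceInterior_closure hS hq]
    obtain ⟨v, hvT, hv0, hv⟩ := h.isNullHypersurface.2 q hq
    exact g.apply_eq_zero_of_null hvT hv0 hv (h.tangent q hq) (h.null q hq)
  exact fun p hp ↦ ⟨mem_tangentSubspace_of_mem_closure ξ.1 h1 hp.1,
    fun w hw ↦ apply_tangentSubspace_eq_zero_of_mem_closure g hI ξ.1 hSI h2 hp hp.1 hw⟩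

/-- The two alternatives in the connectedness condition on a Killing horizon both imply the
second one, as a horizon is dense in the hypersurface interior of its closure. -/
theorem IsKillingHorizon.isConnected_hypersurfaceInterior {g : LorentzianMetric n M}
    {ξ : killingAlgebra g} {S : Set M} (h : IsKillingHorizon g ξ S) :
    IsConnected (hypersurfaceInterior n (closure S)) :=
  h.connected.elim (fun hc ↦ hc.subset_closure
    (subset_hypersurfaceInterior_closure h.isNullHypersurface.1)
    (hypersurfaceInterior_subset _)) id

/-- A nonzero Killing vector which is null-tangent along the hypersurface interior of `C` has a
Killing horizon with closure `C`: the open dense set of points where it does not vanish. -/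
theorem exists_isKillingHorizon_of_isNullTangent [ConnectedSpace M] {g : LorentzianMetric n M}
    {C : Set M} (hC : IsClosed C) (hd : C ⊆ closure (hypersurfaceInterior n C))
    (hconn : IsConnected (hypersurfaceInterior n C)) {ξ : killingAlgebra g} (h0 : ξ ≠ 0)
    (hξ : IsNullTangent g (hypersurfaceInterior n C) ξ.1) :
    ∃ S : Set M, IsKillingHorizon g ξ S ∧ C = closure S := by
  set I := hypersurfaceInterior n C with hI
  have hIs : IsSmoothHypersurface n I := isSmoothHypersurface_hypersurfaceInterior C
  let N : Set M := {q | ξ.1 q ≠ 0}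
  -- near each point, `N` is the nonvanishing set of the continuous chart components of `ξ`
  have hN : IsOpen N := by
    rw [isOpen_iff_mem_nhds]
    intro q hq
    have hqs : q ∈ (extChartAt (𝓡 (n + 1)) q).source := mem_extChartAt_source q
    have hc : ContinuousAt (chartRep q ξ.1 ∘ extChartAt (𝓡 (n + 1)) q) q :=
      ((contDiffOn_chartRep q ξ.1).contDiffAt ((isOpen_extChartAt_target q).mem_nhds
        ((extChartAt (𝓡 (n + 1)) q).map_source hqs))).continuousAt.comp (continuousAt_extChartAt q)
    have key (x) (hx : x ∈ (extChartAt (𝓡 (n + 1)) q).source) :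
        (chartRep q ξ.1 ∘ extChartAt (𝓡 (n + 1)) q) x = 0 ↔ ξ.1 x = 0 := by
      rw [Function.comp_apply, chartRep_eq_zero_iff ξ.1
        ((extChartAt (𝓡 (n + 1)) q).map_source hx), (extChartAt (𝓡 (n + 1)) q).left_inv hx]
    filter_upwards [hc.eventually_ne (mt (key q hqs).1 hq),
      extChartAt_source_mem_nhds (I := 𝓡 (n + 1)) q] with x hx hxs
    exact mt (key x hxs).2 hx
  -- otherwise `ξ` would vanish on an open piece of the hypersurface `I`
  have hdense : I ⊆ closure (I ∩ N) := by
    intro p hp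
    by_contra hne
    refine h0 (Subtype.ext (eq_zero_of_eq_zero_on_hypersurface ξ.2 hIs
      (isClosed_closure (s := I ∩ N)).isOpen_compl (p := p) ⟨hp, hne⟩ fun q hq ↦ ?_))
    by_contra hq0
    exact hq.2 (subset_closure ⟨hq.1, hq0⟩)
  have hcl : C = closure (I ∩ N) := by
    refine Subset.antisymm (hd.trans (closure_minimal hdense isClosed_closure)) ?_
    exact closure_minimal (inter_subset_left.trans (hypersurfaceInterior_subset C)) hC
  have hT (q) (hq : q ∈ I ∩ N) : tangentSubspace n (I ∩ N) q = tangentSubspace n I q :=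
    tangentSubspace_eq_of_inter_eq hN hq.2 (by rw [inter_assoc, inter_self])
  refine ⟨I ∩ N, ⟨?_, ⟨isSmoothHypersurface_inter hIs hN, fun q hq ↦ ?_⟩, fun q hq ↦ ?_,
    fun q hq ↦ hq.2, fun q hq ↦ ?_, ?_⟩, hcl⟩
  · obtain ⟨q, hq⟩ := hconn.nonempty
    exact closure_nonempty_iff.1 ⟨q, hdense hq⟩
  · rw [hT q hq]
    exact ⟨ξ.1 q, (hξ q hq.1).1, hq.2, (hξ q hq.1).2⟩
  · exact (hξ q hq.1).2 _ (hξ q hq.1).1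
  · rw [hT q hq]
    exact (hξ q hq.1).1
  · right
    rwa [← hcl]

/-- The Killing vectors which are null-tangent along a hypersurface form a Lie algebra. -/
def nullTangentSubalgebra (g : LorentzianMetric n M) {S : Set M} (hS : IsSmoothHypersurface n S) :
    LieSubalgebra ℝ (killingAlgebra g) where
  carrier := {ξ | IsNullTangent g S ξ.1}
  zero_mem' := fun p _ ↦ by
    change (0 : TangentSpace (𝓡 (n + 1)) p) ∈ _ ∧ ∀ w ∈ _, g.val p 0 w = 0
    simp
  add_mem' := fun {ξ η} hξ hη p hp ↦ by
    change ξ.1 p + η.1 p ∈ _ ∧ ∀ w ∈ _, g.val p (ξ.1 p + η.1 p) w = 0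
    refine ⟨add_mem (hξ p hp).1 (hη p hp).1, fun w hw ↦ ?_⟩
    simp [(hξ p hp).2 w hw, (hη p hp).2 w hw]
  smul_mem' := fun c ξ hξ p hp ↦ by
    change c • ξ.1 p ∈ _ ∧ ∀ w ∈ _, g.val p (c • ξ.1 p) w = 0
    refine ⟨Submodule.smul_mem _ c (hξ p hp).1, fun w hw ↦ ?_⟩
    simp [(hξ p hp).2 w hw]
  lie_mem' := fun {ξ _} hξ hη ↦ IsNullTangent.lie hS ξ.2 hξ hη

end Horizon

theorem mainTheorem1 {n : ℕ} (hn : 1 ≤ n) {M : Type*} [TopologicalSpace M] [T2Space M]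
    [SecondCountableTopology M] [ConnectedSpace M]
    [ChartedSpace (EuclideanSpace ℝ (Fin (n + 1))) M] [IsManifold (𝓡 (n + 1)) ∞ M]
    (g : LorentzianMetric n M) (H : Set M) (hH : IsMultipleKillingHorizon g H) :
    ∃ L : LieSubalgebra ℝ (killingAlgebra g),
      (L : Set (killingAlgebra g)) = horizonKillingVectors g H := by
  obtain ⟨hnull, m, hm, ξ, S, -, hξS⟩ := hH
  have hI := isSmoothHypersurface_hypersurfaceInterior (n := n) (closure H)
  refine ⟨nullTangentSubalgebra g hI, Set.ext fun η ↦ ⟨fun hη ↦ ?_, ?_⟩⟩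
  · by_cases h0 : η = 0
    · exact Or.inl h0
    · obtain ⟨hS, hcl⟩ := hξS ⟨0, by omega⟩
      refine Or.inr (exists_isKillingHorizon_of_isNullTangent isClosed_closure
        (closure_mono (subset_hypersurfaceInterior_closure hnull.1)) ?_ h0 hη)
      rw [hcl]
      exact hS.isConnected_hypersurfaceInterior
  · rintro (rfl | ⟨S', hS', hcl⟩)
    · exact (nullTangentSubalgebra g hI).zero_mem
    · change IsNullTangent g (hypersurfaceInterior n (closure H)) η.1
      rw [hcl]
      exact hS'.isNullTangent
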